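/- Let $X=((X_t)_{t\ge 0},(\mathbb P_i)_{i\in S})$ be a continuous-time Markov chain with right-continuous paths on a finite or countable state space $S$, with transition probabilities $p_{ij}(t)=\mathbb P_i(X_t=j)$ and $q$-matrix $q_{ij}=p_{ij}'(0)$ (finite). Assume that $X$ is irreducible and not explosive and that $Q=(q_{ij})$ is conservative, i.e. $\sum_{j\in S}q_{ij}=0$ for all $i\in S$. Let $\{E_1,E_2,\dots\}$ be a finite or infinite partition of $S$ into at least two non-empty sets, put $D=E_1$, $E=S\setminus D$ and $T=\inf\{t\ge 0: X_t\in D\}$. Let $\mu$ be a probability distribution on $S$ with support in $E$, write $\mathbb P_\mu=\sum_{i}\mu_i\mathbb P_i$, and assume: (i) for all $k\ge 2$ and $l\ge 1$ with $l\ne k$, the quantity $\bar q_{kl}:=\sum_{j\in E_l}q_{ij}$ does not depend on $i\in E_k$. Put $\bar q_{1l}=0$ for $l\ge 1$, $\bar q_{kk}=-\sum_{l\ne k}\bar q_{kl}$ for $k\ge 2$, $\bar Q=(\bar q_{kl})_{k,l\ge 1}$, $\bar\mu_k=\sum_{i\in E_k}\mu_i$, $\bar\mu=(\bar\mu_k)_{k\ge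 1}$ and $\mathrm d=(1,0,0,\dots)$. Then the following two conditions are equivalent: (ii) for every $k\ge 1$, the probability $\mathbb P_\mu(X_t\in E_k\mid T>t)$ does not depend on $t\ge 0$; (iii) there exists $\alpha>0$ such that $\bar\mu\bar Q=-\alpha\bar\mu+\alpha\,\mathrm d$. Moreover, if (ii) (equivalently (iii)) holds, then $\mathbb P_\mu(X_t\in E_k\mid T>t)=\bar\mu_k$ for all $k\ge 1$ and $t\ge 0$, and $T$ is exponentially distributed under $\mathbb P_\mu$ with parameter $\alpha=\sum_{k\ge 1}\bar q_{k1}\bar\mu_k>0$, the constant of (iii); that is, $\mathbb P_\mu(T>t)=e^{-\alpha t}$ for all $t\ge 0$. -/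

import Mathlib

open MeasureTheory ProbabilityTheory Filter Topology
open scoped NNReal ENNReal

noncomputable section

namespace LumpedChain

variable {S Ω ι : Type*}

/-! ### Continuous-time Markov chains -/

/-- The history of the process `X` up to time `s`: the σ-algebra generated by `X_u`, `u ≤ s`,
where the (countable) state space carries the discrete σ-algebra. -/
abbrev history (X : ℝ≥0 → Ω → S) (s : ℝ≥0) : MeasurableSpace Ω :=
  ⨆ u : Set.Iic s, MeasurableSpace.comap (X u) ⊤

/-- The transition function `p_{ij}(t) = P_i(X_t = j)`. -/
def transition [MeasurableSpace Ω] (X : ℝ≥0 → Ω → S) (P : S → Measure Ω)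
    (t : ℝ≥0) (i j : S) : ℝ :=
  (P i).real {ω | X t ω = j}

/-- `(X, (P_i)_{i ∈ S})` is a (time-homogeneous) continuous-time Markov chain with
right-continuous paths in the discrete space `S`, whose `q`-matrix is `q_{ij} = p_{ij}'(0)`
(one-sided derivative at `0`, assumed to exist and to be finite). -/
structure IsMarkovChain [MeasurableSpace Ω] (X : ℝ≥0 → Ω → S) (P : S → Measure Ω)
    (Q : S → S → ℝ) : Prop where
  /-- each `P_i` is a probability measure -/
  isProbabilityMeasure : ∀ i, IsProbabilityMeasure (P i)
  /-- each `X_t` is a random variable -/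
  measurable : ∀ t j, MeasurableSet {ω | X t ω = j}
  /-- the chain starts at `i` under `P_i` -/
  start : ∀ i, P i {ω | X 0 ω = i} = 1
  /-- the Markov property with respect to the natural filtration -/
  markov : ∀ (i : S) (s t : ℝ≥0) (A : Set Ω), MeasurableSet[history X s] A →
    ∀ j k : S, P i (A ∩ {ω | X s ω = j} ∩ {ω | X (s + t) ω = k}) =
      P i (A ∩ {ω | X s ω = j}) * P j {ω | X t ω = k}
  /-- paths are right-continuous for the discrete topology of `S` -/
  rightContinuous : ∀ ω t, ∀ᶠ s in 𝓝[≥] t, X s ω = X t ω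
  /-- `q_{ij} = p_{ij}'(0)` -/
  hasDerivWithinAt : ∀ i j,
    HasDerivWithinAt (fun t : ℝ => transition X P t.toNNReal i j) (Q i j) (Set.Ici 0) 0

/-- Irreducibility: every state can be reached from every state. -/
def IsIrreducible [MeasurableSpace Ω] (X : ℝ≥0 → Ω → S) (P : S → Measure Ω) : Prop :=
  ∀ i j, ∃ t, 0 < transition X P t i j

/-- The `q`-matrix is conservative: all its rows sum to `0`. -/
def IsConservative (Q : S → S → ℝ) : Prop :=
  ∀ i, HasSum (Q i) 0

/-- The chain is not explosive: almost surely, there are only finitely many jump times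
(times at which the path is not locally constant) in every bounded time interval. -/
def IsNonexplosive [MeasurableSpace Ω] (X : ℝ≥0 → Ω → S) (P : S → Measure Ω) : Prop :=
  ∀ i, ∀ᵐ ω ∂(P i), ∀ t : ℝ≥0, {s | s ≤ t ∧ ¬ ∀ᶠ u in 𝓝 s, X u ω = X s ω}.Finite

/-- The law `P_μ = ∑_i μ_i P_i` of the chain with initial distribution `μ`. -/
def startFrom [MeasurableSpace Ω] (P : S → Measure Ω) (μ : PMF S) : Measure Ω :=
  Measure.sum fun i => μ i • P i

/-- The event `{T > t}`, where `T = inf {t ≥ 0 : X_t ∈ D}` (`= ⊤` if `D` is never visited). -/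
def survival (X : ℝ≥0 → Ω → S) (D : Set S) (t : ℝ≥0) : Set Ω :=
  {ω | (t : WithTop ℝ≥0) < hittingAfter X D 0 ω}

/-! ### Partitions and lumping -/

/-- A partition of `S` into nonempty, pairwise disjoint blocks indexed by `ι`. -/
structure BlockPartition (S ι : Type*) where
  block : ι → Set S
  nonempty : ∀ k, (block k).Nonempty
  disjoint : Pairwise fun k l => Disjoint (block k) (block l)
  cover : ⋃ k, block k = Set.univ

/-- The total rate `∑_{j ∈ A} q_{ij}` from the state `i` to the set `A`. -/
def rateTo (Q : S → S → ℝ) (i : S) (A : Set S) : ℝ :=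
  ∑' j : A, Q i j

/-- Lumpability, `o` being the index of the block that kills the chain: for all `k ≠ o` and
`l ≠ k`, the rate from `i ∈ E_k` to `E_l` does not depend on `i`. -/
def IsLumpable (Q : S → S → ℝ) (E : BlockPartition S ι) (o : ι) : Prop :=
  ∀ k l, k ≠ o → l ≠ k → ∀ i ∈ E.block k, ∀ i' ∈ E.block k,
    rateTo Q i (E.block l) = rateTo Q i' (E.block l)

/-- The common value of the rates from the states of `E_k` to `E_l`, evaluated at some state
of `E_k`. -/
def blockRate (Q : S → S → ℝ) (E : BlockPartition S ι) (k l : ι) : ℝ :=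
  rateTo Q (E.nonempty k).some (E.block l)

open Classical in
/-- The lumped matrix `Q̄`: its row `o` vanishes, its off-diagonal entries in the other rows are
the block rates, and its diagonal makes the rows sum to `0`. -/
def lumpedMatrix (Q : S → S → ℝ) (E : BlockPartition S ι) (o k l : ι) : ℝ :=
  if k = o then 0
  else if l = k then -∑' m : {m : ι // m ≠ k}, blockRate Q E k m
  else blockRate Q E k l

/-- The lumped law `μ̄_k = ∑_{i ∈ E_k} μ_i`. -/
def lumpedLaw (μ : PMF S) (E : BlockPartition S ι) (k : ι) : ℝ :=
  ∑' i : E.block k, (μ i).toReal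

/-- The equation `μ̄ Q̄ = -α μ̄ + α d`, where `d` is the unit row vector at `o`. -/
def LumpedEquation (Q : S → S → ℝ) (μ : PMF S) (E : BlockPartition S ι) (o : ι) (α : ℝ) : Prop :=
  ∀ l, HasSum (fun k => lumpedLaw μ E k * lumpedMatrix Q E o k l)
    (-α * lumpedLaw μ E l + α * Set.indicator {o} 1 l)

/-- The block occupation probability `P_μ(X_t ∈ E_k | T > t)`, where `T` is the first passage
time in the block `E_o`. -/
def occupation [MeasurableSpace Ω] (X : ℝ≥0 → Ω → S) (P : S → Measure Ω) (μ : PMF S)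
    (E : BlockPartition S ι) (o : ι) (t : ℝ≥0) (k : ι) : ℝ :=
  (cond (startFrom P μ) (survival X (E.block o) t)).real {ω | X t ω ∈ E.block k}

end LumpedChain

end

/-!
Let `D = E_o`. The proof describes the block-valued chain killed in `D` by the taboo probabilities
`ν(X_u ∈ W for u ≤ t, X_t ∈ B)` (`taboo`), where `W = Dᶜ`, or where `W` (`region`) is the union of
finitely many blocks other than `D`.

*Lumping.* Taboo probabilities are limits of probabilities along dyadic skeletons, so they satisfy
the Chapman–Kolmogorov equation (`hasSum_taboo_add`), and those issued from a state `i` have the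
derivative `∑_{j ∈ B ∩ W} q_{ij}` at `0` (`hasDerivWithinAt_taboo`). By nonexplosion a path visits
only finitely many states before time `t`, and this gives bounds of first-passage probabilities by
rates (`exit_le`). In particular a state of the block `k` leaves that block before `t` with
probability at most `-t q̄_{kk}`, uniformly in the state, even if the individual rates of the states
of the block are unbounded. With this domination the block probabilities in finitely many blocks
satisfy the linear system `F' = F Q̄` (`hasDerivWithinAt_taboo_region`); they are determined by the
initial block, because the solution is unique (`taboo_region_congr`). Exhausting all the blocks by
finitely many, which is where nonexplosion is used again, gives the same for the chain killed in
`D`.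

*From the equation to the exponential law.* If `μ̄ Q̄ = -α μ̄ + α d`, the backward equation in finitely
many blocks shows that the killed lumped law is at most `e^{-αt} μ̄` (`taboo_le_exp_mul`), so that
survival has probability at most `e^{-αt}`. As `∑_k μ̄_k q̄_{ko} = α`, the first-passage bound shows
that the mass lost in the time interval `[t, t + h]` is at most `e^{-αt} α h`, so that survival has
probability at least `e^{-αt}` (`survival_eq_exp`). Hence both bounds are equalities.

*From constant occupation to the equation.* If the conditional law of the block does not depend on
time, it is its value `μ̄` at time `0`, the survival probability is multiplicative, thus equal to
`e^{-αt}`, and `α > 0` by irreducibility (`exists_taboo_eq_exp_of_occupation`). Differentiating the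
killed lumped law `e^{-αt} μ̄` at `0` with Fatou's lemma gives one inequality in each coordinate of
the equation. The opposite one comes from the first-passage bound for the coordinate `o`, and from
the forward equation in finitely many blocks for the others (`lumpedEquation_of_taboo_eq`).
-/

namespace LumpedChain

/-! ### Right-continuous paths in a discrete space -/

/-- The event that the path stays in `W` up to time `t` (included). -/
def stay {S Ω : Type*} (X : ℝ≥0 → Ω → S) (W : Set S) (t : ℝ≥0) : Set Ω :=
  {ω | ∀ u ≤ t, X u ω ∈ W}

/-- The event that the path is in `W` at the times `s, s + δ, …, s + n δ`. -/
def skeleton {S Ω : Type*} (X : ℝ≥0 → Ω → S) (W : Set S) (s δ : ℝ≥0) (n : ℕ) : Set Ω :=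
  {ω | ∀ m ≤ n, X (s + m * δ) ω ∈ W}

section Paths

variable {S Ω : Type*} {X : ℝ≥0 → Ω → S}

lemma stay_mono {V W : Set S} (h : V ⊆ W) (t : ℝ≥0) : stay X V t ⊆ stay X W t :=
  fun _ hω u hu => h (hω u hu)

lemma stay_anti (W : Set S) {s t : ℝ≥0} (h : s ≤ t) : stay X W t ⊆ stay X W s :=
  fun _ hω u hu => hω u (hu.trans h)

lemma stay_add (W : Set S) (s t : ℝ≥0) :
    stay X W (s + t) = stay X W s ∩ {ω | ∀ u ≤ t, X (s + u) ω ∈ W} := by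
  ext ω
  constructor
  · exact fun h => ⟨fun u hu => h u (hu.trans le_self_add), fun u hu => h _ (by gcongr)⟩
  · rintro ⟨h1, h2⟩ u hu
    rcases le_total u s with h | h
    · exact h1 u h
    · have := h2 (u - s) (by rwa [tsub_le_iff_left])
      rwa [add_tsub_cancel_of_le h] at this

/-- By right-continuity, a path stays in `W` as soon as it does so along the dyadic subdivisions,
which are chosen to contain the end point `t`. -/
lemma iInter_skeleton (hX : ∀ ω t, ∀ᶠ s in 𝓝[≥] t, X s ω = X t ω) (W : Set S) (s t : ℝ≥0) :
    ⋂ r : ℕ, skeleton X W s (t / 2 ^ r) (2 ^ r) = {ω | ∀ u ≤ t, X (s + u) ω ∈ W} := by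
  ext ω
  simp only [Set.mem_iInter]
  constructor
  · intro h u hu
    by_contra hW
    have htpos : 0 < t := by
      rcases eq_or_ne t 0 with rfl | h0
      · have h1 := h 0 0 (by simp)
        have : u = 0 := le_antisymm hu bot_le
        subst this
        simp at h1 hW
        exact absurd h1 hW
      · exact pos_iff_ne_zero.2 h0
    let m : ℕ → ℕ := fun r => ⌈u * 2 ^ r / t⌉₊
    have hm : ∀ r, m r ≤ 2 ^ r := fun r => by
      apply Nat.ceil_le.2
      rw [div_le_iff₀ htpos, mul_comm]
      push_cast
      gcongr
    have hlow : ∀ r, u ≤ m r * (t / 2 ^ r) := fun r => by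
      have := Nat.le_ceil (u * 2 ^ r / t)
      rw [div_le_iff₀ htpos] at this
      rw [← mul_div_assoc, le_div_iff₀ (by positivity)]
      exact this
    have hup : ∀ r, m r * (t / 2 ^ r) ≤ u + t / 2 ^ r := fun r => by
      have := (Nat.ceil_lt_add_one (zero_le : 0 ≤ u * 2 ^ r / t)).le
      calc (m r : ℝ≥0) * (t / 2 ^ r) ≤ (u * 2 ^ r / t + 1) * (t / 2 ^ r) := by gcongr
        _ = u + t / 2 ^ r := by field_simp
    have h0 : Tendsto (fun r : ℕ => t / 2 ^ r) atTop (𝓝 0) := by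
      have h2 : (2⁻¹ : ℝ≥0) < 1 := by rw [← NNReal.coe_lt_coe]; push_cast; norm_num
      have := (tendsto_pow_atTop_nhds_zero_of_lt_one zero_le h2).const_mul t
      simpa [div_eq_mul_inv] using this
    have hlim : Tendsto (fun r => s + m r * (t / 2 ^ r)) atTop (𝓝[≥] (s + u)) := by
      refine tendsto_nhdsWithin_iff.2 ⟨?_, Eventually.of_forall fun r => ?_⟩
      · refine Tendsto.const_add s ?_
        refine tendsto_of_tendsto_of_tendsto_of_le_of_le tendsto_const_nhds ?_ hlow hup
        simpa using h0.const_add u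
      · exact add_le_add_right (hlow r) s
    obtain ⟨r, hr⟩ := (hlim.eventually (hX ω (s + u))).exists
    exact hW (hr ▸ h r (m r) (hm r))
  · intro h r m hm
    refine h _ ?_
    calc (m : ℝ≥0) * (t / 2 ^ r) ≤ (2 ^ r : ℕ) * (t / 2 ^ r) := by gcongr
      _ = t := by push_cast; field_simp

lemma antitone_skeleton (W : Set S) (s t : ℝ≥0) :
    Antitone fun r : ℕ => skeleton X W s (t / 2 ^ r) (2 ^ r) := by
  refine antitone_nat_of_succ_le fun r ω h m hm => ?_
  have := h (2 * m) (by rw [pow_succ]; omega)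
  convert this using 2
  push_cast
  rw [pow_succ]
  field_simp

lemma survival_eq_stay (hX : ∀ ω t, ∀ᶠ s in 𝓝[≥] t, X s ω = X t ω) (D : Set S) (t : ℝ≥0) :
    survival X D t = stay X Dᶜ t := by
  ext ω
  simp only [survival, stay, Set.mem_ofPred_eq, Set.mem_compl_iff]
  constructor
  · intro h u hu
    exact notMem_of_lt_hittingAfter (lt_of_le_of_lt (WithTop.coe_le_coe.2 hu) h) bot_le
  · intro h
    by_contra hle
    rw [not_lt, hittingAfter_def] at hle
    beta_reduce at hle
    split_ifs at hle with hex
    · rw [WithTop.coe_le_coe] at hle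
      set A : Set ℝ≥0 := {i | 0 ≤ i ∧ X i ω ∈ D}
      have hA : A.Nonempty := hex
      -- the infimum is attained, since the path is right-continuous
      have hmem : X (sInf A) ω ∈ D := by
        by_contra hD
        obtain ⟨b, hb, hb'⟩ := (mem_nhdsGE_iff_exists_Ico_subset).1 (hX ω (sInf A))
        obtain ⟨c, hc, hcb⟩ := (csInf_lt_iff (OrderBot.bddBelow A) hA).1 hb
        have := hb' ⟨csInf_le (OrderBot.bddBelow A) hc, hcb⟩
        exact hD (this ▸ hc.2)
      exact h _ hle hmem
    · exact absurd hle (WithTop.not_top_le_coe t)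

/-- A right-continuous path with finitely many jumps in `[0, t]` has a finite range there. -/
lemma finite_image_Iic {x : ℝ≥0 → S} (hx : ∀ t, ∀ᶠ s in 𝓝[≥] t, x s = x t) {t : ℝ≥0}
    (hJ : {s | s ≤ t ∧ ¬ ∀ᶠ u in 𝓝 s, x u = x s}.Finite) : (x '' Set.Iic t).Finite := by
  have hcomp : IsCompact (Set.Iic t) := by
    rw [← Set.Icc_bot]; exact isCompact_Icc
  refine hcomp.induction_on (p := fun A => (x '' A).Finite) (by simp)
    (fun A B hAB hB => hB.subset (Set.image_mono hAB))
    (fun A B hA hB => by rw [Set.image_union]; exact hA.union hB) fun s hs => ?_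
  set J := {s | s ≤ t ∧ ¬ ∀ᶠ u in 𝓝 s, x u = x s} with hJdef
  have hcl : (J \ {s})ᶜ ∈ 𝓝 s :=
    (hJ.subset Set.sdiff_subset).isClosed.isOpen_compl.mem_nhds (by simp)
  have key : ∃ B : Set ℝ≥0, B ∈ 𝓝[<] s ∧ (x '' B).Finite := by
    rcases eq_or_ne s 0 with rfl | hs0
    · exact ⟨∅, by simp, by simp⟩
    · obtain ⟨a, ha, ha'⟩ := exists_Ioc_subset_of_mem_nhds hcl ⟨0, pos_iff_ne_zero.2 hs0⟩
      refine ⟨Set.Ioo a s, Ioo_mem_nhdsLT ha, Set.Subsingleton.finite ?_⟩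
      let _ : TopologicalSpace S := ⊥
      have : DiscreteTopology S := ⟨rfl⟩
      have hcont : ContinuousOn x (Set.Ioo a s) := by
        intro u hu
        apply ContinuousAt.continuousWithinAt
        have huJ : u ∉ J := fun h => ha' ⟨hu.1, hu.2.le⟩ ⟨h, hu.2.ne⟩
        have : ∀ᶠ v in 𝓝 u, x v = x u := by
          by_contra hcon
          exact huJ ⟨hu.2.le.trans hs, hcon⟩
        exact (tendsto_const_nhds (x := x u)).congr' (this.mono fun v hv => hv.symm)
      rintro _ ⟨u, hu, rfl⟩ _ ⟨v, hv, rfl⟩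
      exact isPreconnected_Ioo.constant hcont hu hv
  obtain ⟨B, hB, hBfin⟩ := key
  refine ⟨B ∪ {u | x u = x s}, mem_nhdsWithin_of_mem_nhds ?_, ?_⟩
  · rw [← nhdsLT_sup_nhdsGE]
    exact ⟨mem_of_superset hB Set.subset_union_left,
      mem_of_superset (hx s) Set.subset_union_right⟩
  · rw [Set.image_union]
    refine hBfin.union ((Set.finite_singleton (x s)).subset ?_)
    rintro _ ⟨u, hu, rfl⟩
    exact hu

end Paths

/-! ### Measurability -/

section Measurability

variable {S Ω : Type*} {X : ℝ≥0 → Ω → S}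

lemma measurableSet_history_preimage {u s : ℝ≥0} (h : u ≤ s) (B : Set S) :
    MeasurableSet[history X s] {ω | X u ω ∈ B} := by
  have : MeasurableSpace.comap (X u) ⊤ ≤ history X s :=
    le_iSup (fun u : Set.Iic s => MeasurableSpace.comap (X u) ⊤) ⟨u, h⟩
  exact this _ ⟨B, trivial, rfl⟩

lemma measurableSet_history_skeleton (W : Set S) {s δ s' : ℝ≥0} {n : ℕ} (h : s + n * δ ≤ s') :
    MeasurableSet[history X s'] (skeleton X W s δ n) := by
  have : skeleton X W s δ n = ⋂ m : ℕ, ⋂ _ : m ≤ n, {ω | X (s + m * δ) ω ∈ W} := by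
    ext; simp [skeleton]
  rw [this]
  refine MeasurableSet.iInter fun m => MeasurableSet.iInter fun hm =>
    measurableSet_history_preimage ?_ W
  refine le_trans ?_ h
  gcongr

lemma measurableSet_history_stay (hX : ∀ ω t, ∀ᶠ s in 𝓝[≥] t, X s ω = X t ω) (W : Set S)
    (t : ℝ≥0) : MeasurableSet[history X t] (stay X W t) := by
  have : stay X W t = ⋂ r : ℕ, skeleton X W 0 (t / 2 ^ r) (2 ^ r) := by
    rw [iInter_skeleton hX]; simp [stay]
  rw [this]
  refine MeasurableSet.iInter fun r => measurableSet_history_skeleton W ?_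
  push_cast
  rw [zero_add, mul_div_cancel₀ _ (by positivity)]

variable [Countable S] [MeasurableSpace Ω] {P : S → Measure Ω} {Q : S → S → ℝ}

lemma IsMarkovChain.measurableSet_preimage (hX : IsMarkovChain X P Q) (t : ℝ≥0) (B : Set S) :
    MeasurableSet {ω | X t ω ∈ B} := by
  have : {ω | X t ω ∈ B} = ⋃ j ∈ B, {ω | X t ω = j} := by ext; simp
  rw [this]
  exact MeasurableSet.biUnion B.to_countable fun j _ => hX.measurable t j

lemma IsMarkovChain.history_le (hX : IsMarkovChain X P Q) (t : ℝ≥0) :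
    history X t ≤ ‹MeasurableSpace Ω› := by
  refine iSup_le fun u => ?_
  rintro _ ⟨B, -, rfl⟩
  exact hX.measurableSet_preimage u B

lemma IsMarkovChain.measurableSet_stay (hX : IsMarkovChain X P Q) (W : Set S) (t : ℝ≥0) :
    MeasurableSet (stay X W t) :=
  hX.history_le t _ (measurableSet_history_stay hX.rightContinuous W t)

lemma IsMarkovChain.measurableSet_skeleton (hX : IsMarkovChain X P Q) (W : Set S) (s δ : ℝ≥0)
    (n : ℕ) : MeasurableSet (skeleton X W s δ n) :=
  hX.history_le _ _ (measurableSet_history_skeleton W le_rfl)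

end Measurability

/-! ### The Markov property for path events -/

/-- `ν` is a law under which `X` is a Markov chain with the transition probabilities of `(P_i)`.
All the `P_i` are such laws, and so is every mixture `startFrom P μ`. -/
structure IsMarkovLaw {S Ω : Type*} [MeasurableSpace Ω] (X : ℝ≥0 → Ω → S) (P : S → Measure Ω)
    (ν : Measure Ω) : Prop where
  isProbabilityMeasure : IsProbabilityMeasure ν
  markov : ∀ (s t : ℝ≥0) (A : Set Ω), MeasurableSet[history X s] A → ∀ j k : S,
    ν (A ∩ {ω | X s ω = j} ∩ {ω | X (s + t) ω = k}) =
      ν (A ∩ {ω | X s ω = j}) * P j {ω | X t ω = k}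

/-- The taboo probability `ν(X_u ∈ W for all u ≤ t, X_t ∈ B)`. -/
noncomputable def taboo {S Ω : Type*} [MeasurableSpace Ω] (X : ℝ≥0 → Ω → S) (ν : Measure Ω)
    (W : Set S) (t : ℝ≥0) (B : Set S) : ℝ :=
  ν.real (stay X W t ∩ {ω | X t ω ∈ B})

section

variable {S Ω : Type*} [MeasurableSpace Ω] {X : ℝ≥0 → Ω → S} {P : S → Measure Ω}
  {Q : S → S → ℝ} {ν : Measure Ω}

lemma IsMarkovChain.isMarkovLaw (hX : IsMarkovChain X P Q) (i : S) : IsMarkovLaw X P (P i) :=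
  ⟨hX.isProbabilityMeasure i, fun s t A hA j k => hX.markov i s t A hA j k⟩

lemma startFrom_apply (μ : PMF S) {A : Set Ω} (hA : MeasurableSet A) :
    startFrom P μ A = ∑' i, μ i * P i A := by
  simp [startFrom, Measure.sum_apply _ hA]

lemma measure_eq_tsum_inter [Countable S] (hX : IsMarkovChain X P Q) (ν : Measure Ω) {G : Set Ω}
    (hG : MeasurableSet G) (t : ℝ≥0) : ν G = ∑' k, ν (G ∩ {ω | X t ω = k}) := by
  rw [← measure_iUnion]
  · congr 1; ext ω; simp
  · intro k l hkl
    refine Set.disjoint_left.2 fun ω h1 h2 => hkl ?_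
    exact h1.2.symm.trans h2.2
  · exact fun k => hG.inter (hX.measurable t k)

lemma IsMarkovChain.measure_start_inter (hX : IsMarkovChain X P Q) (j : S) (G : Set Ω) :
    P j ({ω | X 0 ω = j} ∩ G) = P j G := by
  have := hX.isProbabilityMeasure j
  have h : ∀ᵐ ω ∂(P j), X 0 ω = j :=
    (prob_compl_eq_zero_iff (hX.measurable 0 j)).2 (hX.start j)
  refine measure_congr ?_
  filter_upwards [h] with ω hω
  apply propext
  exact ⟨fun h => h.2, fun h => ⟨hω, h⟩⟩

lemma taboo_nonneg (ν : Measure Ω) (W : Set S) (t : ℝ≥0) (B : Set S) : 0 ≤ taboo X ν W t B :=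
  measureReal_nonneg

lemma taboo_le_one (ν : Measure Ω) [IsProbabilityMeasure ν] (W : Set S) (t : ℝ≥0) (B : Set S) :
    taboo X ν W t B ≤ 1 :=
  measureReal_le_one

lemma taboo_mono [IsFiniteMeasure ν] {V W B C : Set S} (hVW : V ⊆ W) (hBC : B ⊆ C) (t : ℝ≥0) :
    taboo X ν V t B ≤ taboo X ν W t C :=
  measureReal_mono (Set.inter_subset_inter (stay_mono hVW t) fun _ h => hBC h)

lemma taboo_eq_zero_of_disjoint {W B : Set S} (h : Disjoint W B) (ν : Measure Ω) (t : ℝ≥0) :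
    taboo X ν W t B = 0 := by
  have : stay X W t ∩ {ω | X t ω ∈ B} = ∅ := by
    ext ω
    simp only [Set.mem_inter_iff, Set.mem_ofPred_eq, stay, Set.mem_empty_iff_false, iff_false]
    exact fun ⟨h1, h2⟩ => Set.disjoint_left.1 h (h1 t le_rfl) h2
  rw [taboo, this]; simp

lemma taboo_of_notMem_start (hX : IsMarkovChain X P Q) {i : S} {W : Set S} (hi : i ∉ W) (t : ℝ≥0)
    (B : Set S) : taboo X (P i) W t B = 0 := by
  rw [taboo, measureReal_def, ← hX.measure_start_inter]
  have : {ω | X 0 ω = i} ∩ (stay X W t ∩ {ω | X t ω ∈ B}) = ∅ := by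
    ext ω
    simp only [Set.mem_inter_iff, Set.mem_ofPred_eq, stay, Set.mem_empty_iff_false, iff_false]
    rintro ⟨h1, h2, -⟩
    exact hi (h1 ▸ h2 0 bot_le)
  rw [this]; simp

open Classical in
lemma taboo_zero (hX : IsMarkovChain X P Q) {i : S} {W : Set S} (hi : i ∈ W) (B : Set S) :
    taboo X (P i) W 0 B = if i ∈ B then 1 else 0 := by
  have := hX.isProbabilityMeasure i
  rw [taboo, measureReal_def, ← hX.measure_start_inter]
  split_ifs with h
  · have : {ω | X 0 ω = i} ∩ (stay X W 0 ∩ {ω | X 0 ω ∈ B}) = {ω | X 0 ω = i} := by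
      ext ω
      simp only [Set.mem_inter_iff, Set.mem_ofPred_eq, stay]
      constructor
      · exact fun h => h.1
      · intro h1
        refine ⟨h1, fun u hu => ?_, h1 ▸ h⟩
        obtain rfl : u = 0 := le_antisymm hu bot_le
        exact h1 ▸ hi
    rw [this, hX.start]; simp
  · have : {ω | X 0 ω = i} ∩ (stay X W 0 ∩ {ω | X 0 ω ∈ B}) = ∅ := by
      ext ω
      simp only [Set.mem_inter_iff, Set.mem_ofPred_eq, stay, Set.mem_empty_iff_false, iff_false]
      rintro ⟨h1, -, h2⟩
      exact h (h1 ▸ h2)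
    rw [this]; simp

variable [Countable S]

lemma IsMarkovChain.isMarkovLaw_startFrom (hX : IsMarkovChain X P Q) (μ : PMF S) :
    IsMarkovLaw X P (startFrom P μ) where
  isProbabilityMeasure := by
    constructor
    rw [startFrom_apply μ MeasurableSet.univ, ← μ.tsum_coe]
    congr 1; ext i
    have := hX.isProbabilityMeasure i
    simp
  markov s t A hA j k := by
    have hA' := hX.history_le s A hA
    rw [startFrom_apply μ ((hA'.inter (hX.measurable s j)).inter (hX.measurable _ k)),
      startFrom_apply μ (hA'.inter (hX.measurable s j)), ← ENNReal.tsum_mul_right]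
    congr 1; ext i
    rw [hX.markov i s t A hA j k, mul_assoc]

lemma measure_skeleton_succ (hX : IsMarkovChain X P Q) (hν : IsMarkovLaw X P ν) (W : Set S)
    (s δ : ℝ≥0) (n : ℕ) {A : Set Ω} (hA : MeasurableSet[history X s] A) {k : S} (hk : k ∈ W) :
    ν (A ∩ (skeleton X W s δ (n + 1) ∩ {ω | X (s + (n + 1 : ℕ) * δ) ω = k})) =
      ∑' l, ν (A ∩ (skeleton X W s δ n ∩ {ω | X (s + n * δ) ω = l})) * P l {ω | X δ ω = k} := by
  have hA' := hX.history_le s A hA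
  rw [measure_eq_tsum_inter hX ν (hA'.inter ((hX.measurableSet_skeleton W s δ (n + 1)).inter
    (hX.measurable _ k))) (s + n * δ)]
  congr 1; ext l
  have hhist : MeasurableSet[history X (s + n * δ)] (A ∩ skeleton X W s δ n) := by
    refine MeasurableSet.inter ?_ (measurableSet_history_skeleton W le_rfl)
    have : history X s ≤ history X (s + n * δ) :=
      iSup_le fun u => le_iSup (fun u : Set.Iic (s + n * δ) => MeasurableSpace.comap (X u) ⊤)
        ⟨u, Set.mem_Iic.2 (le_trans (Set.mem_Iic.1 u.2) le_self_add)⟩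
    exact this A hA
  have htime : s + (n + 1 : ℕ) * δ = s + n * δ + δ := by push_cast; ring
  rw [← Set.inter_assoc A (skeleton X W s δ n), ← hν.markov (s + n * δ) δ _ hhist l k]
  congr 1
  ext ω
  simp only [Set.mem_inter_iff, Set.mem_ofPred_eq, skeleton, htime]
  constructor
  · rintro ⟨⟨h1, h2, h3⟩, h4⟩
    exact ⟨⟨⟨h1, fun m hm => h2 m (by omega)⟩, h4⟩, h3⟩
  · rintro ⟨⟨⟨h1, h2⟩, h4⟩, h3⟩
    refine ⟨⟨h1, fun m hm => ?_, h3⟩, h4⟩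
    rcases Nat.lt_or_eq_of_le hm with hm | rfl
    · exact h2 m (by omega)
    · rw [htime, h3]; exact hk

lemma measure_skeleton (hX : IsMarkovChain X P Q) (hν : IsMarkovLaw X P ν) (W : Set S)
    (s δ : ℝ≥0) (n : ℕ) {A : Set Ω} (hA : MeasurableSet[history X s] A) (j k : S) :
    ν (A ∩ {ω | X s ω = j} ∩ (skeleton X W s δ n ∩ {ω | X (s + n * δ) ω = k})) =
      ν (A ∩ {ω | X s ω = j}) *
        P j ({ω | X 0 ω = j} ∩ (skeleton X W 0 δ n ∩ {ω | X (0 + n * δ) ω = k})) := by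
  have hj : ∀ (t : ℝ≥0), MeasurableSet[history X t] {ω | X t ω = j} :=
    fun t => measurableSet_history_preimage le_rfl {j}
  induction n generalizing k with
  | zero =>
    by_cases hkj : k = j ∧ j ∈ W
    · obtain ⟨rfl, hW⟩ := hkj
      have h1 : A ∩ {ω | X s ω = k} ∩ (skeleton X W s δ 0 ∩ {ω | X (s + (0 : ℕ) * δ) ω = k}) =
          A ∩ {ω | X s ω = k} := by
        ext ω; simp only [skeleton, Set.mem_inter_iff, Set.mem_ofPred_eq]
        constructor
        · exact fun h => h.1
        · intro h; refine ⟨h, fun m hm => ?_, by simpa using h.2⟩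
          obtain rfl : m = 0 := by omega
          simpa [h.2] using hW
      have h2 : {ω | X 0 ω = k} ∩ (skeleton X W 0 δ 0 ∩ {ω | X (0 + (0 : ℕ) * δ) ω = k}) =
          {ω | X 0 ω = k} := by
        ext ω; simp only [skeleton, Set.mem_inter_iff, Set.mem_ofPred_eq]
        constructor
        · exact fun h => h.1
        · intro h; refine ⟨h, fun m hm => ?_, by simpa using h⟩
          obtain rfl : m = 0 := by omega
          simpa [h] using hW
      rw [h1, h2, hX.start, mul_one]
    · have h1 : ∀ (B : Set Ω) (t : ℝ≥0),
          B ∩ {ω | X t ω = j} ∩ (skeleton X W t δ 0 ∩ {ω | X (t + (0 : ℕ) * δ) ω = k}) = ∅ := by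
        intro B t
        ext ω
        simp only [skeleton, Set.mem_inter_iff, Set.mem_ofPred_eq, Set.mem_empty_iff_false,
          iff_false]
        rintro ⟨⟨-, h1⟩, h2, h3⟩
        have h2 := h2 0 le_rfl
        simp only [Nat.cast_zero, zero_mul, add_zero] at h2 h3
        exact hkj ⟨h3.symm.trans h1, h1 ▸ h2⟩
      have h2 := h1 Set.univ 0
      rw [Set.univ_inter] at h2
      rw [h1, h2]; simp
  | succ n ih =>
    by_cases hk : k ∈ W
    · rw [measure_skeleton_succ hX hν W s δ n (hA.inter (hj s)) hk,
        measure_skeleton_succ hX (hX.isMarkovLaw j) W 0 δ n (hj 0) hk, ← ENNReal.tsum_mul_left]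
      congr 1; ext l
      rw [ih l, mul_assoc]
    · have h1 : ∀ t : ℝ≥0, skeleton X W t δ (n + 1) ∩ {ω | X (t + (n + 1 : ℕ) * δ) ω = k} = ∅ := by
        intro t
        ext ω
        simp only [skeleton, Set.mem_inter_iff, Set.mem_ofPred_eq, Set.mem_empty_iff_false,
          iff_false]
        rintro ⟨h2, h3⟩
        exact hk (h3 ▸ h2 (n + 1) le_rfl)
      rw [h1, h1]; simp

lemma tendsto_measure_skeleton (hX : IsMarkovChain X P Q) (ν : Measure Ω) [IsFiniteMeasure ν]
    (W : Set S) (s t : ℝ≥0) {G : Set Ω} (hG : MeasurableSet G) (k : S) :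
    Tendsto (fun r : ℕ => ν (G ∩ (skeleton X W s (t / 2 ^ r) (2 ^ r) ∩ {ω | X (s + t) ω = k})))
      atTop (𝓝 (ν (G ∩ ({ω | ∀ u ≤ t, X (s + u) ω ∈ W} ∩ {ω | X (s + t) ω = k})))) := by
  have h := tendsto_measure_iInter_atTop (μ := ν)
    (s := fun r : ℕ => G ∩ (skeleton X W s (t / 2 ^ r) (2 ^ r) ∩ {ω | X (s + t) ω = k}))
    (fun r => (hG.inter ((hX.measurableSet_skeleton W s _ _).inter
      (hX.measurable _ k))).nullMeasurableSet)
    (fun r r' hr ω hω => ⟨hω.1, antitone_skeleton W s t hr hω.2.1, hω.2.2⟩)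
    ⟨0, measure_ne_top _ _⟩
  rw [← iInter_skeleton hX.rightContinuous W s t, Set.iInter_inter, Set.inter_iInter]
  exact h

/-- The Markov property at time `s` for the taboo event of the future, a limit of the one for
skeletons. -/
lemma measure_stay_future_singleton (hX : IsMarkovChain X P Q) (hν : IsMarkovLaw X P ν)
    (W : Set S) (s t : ℝ≥0) {A : Set Ω} (hA : MeasurableSet[history X s] A) (j k : S) :
    ν (A ∩ {ω | X s ω = j} ∩ ({ω | ∀ u ≤ t, X (s + u) ω ∈ W} ∩ {ω | X (s + t) ω = k})) =
      ν (A ∩ {ω | X s ω = j}) * P j (stay X W t ∩ {ω | X t ω = k}) := by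
  have := hν.isProbabilityMeasure
  have hA' := hX.history_le s A hA
  have hPj := hX.isProbabilityMeasure j
  have h1 := tendsto_measure_skeleton hX ν W s t (hA'.inter (hX.measurable s j)) k
  have h2 := tendsto_measure_skeleton hX (P j) W 0 t (hX.measurable 0 j) k
  have h3 := ENNReal.Tendsto.const_mul (a := ν (A ∩ {ω | X s ω = j})) h2
    (Or.inr (measure_ne_top _ _))
  have htime : ∀ (r : ℕ), ((2 ^ r : ℕ) : ℝ≥0) * (t / 2 ^ r) = t := fun r => by
    push_cast; rw [mul_div_cancel₀ _ (by positivity)]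
  have h4 := tendsto_nhds_unique h1 (h3.congr fun r => by
    have := measure_skeleton hX hν W s (t / 2 ^ r) (2 ^ r) hA j k
    rw [htime] at this
    exact this.symm)
  rw [h4, hX.measure_start_inter]
  simp [stay]

lemma measure_inter_preimage (hX : IsMarkovChain X P Q) (ν : Measure Ω) {G : Set Ω}
    (hG : MeasurableSet G) (t : ℝ≥0) (B : Set S) :
    ν (G ∩ {ω | X t ω ∈ B}) = ∑' k : B, ν (G ∩ {ω | X t ω = k}) := by
  rw [← measure_iUnion]
  · congr 1; ext ω; simp
  · intro k l hkl
    refine Set.disjoint_left.2 fun ω h1 h2 => hkl (Subtype.ext ?_)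
    exact h1.2.symm.trans h2.2
  · exact fun k => hG.inter (hX.measurable t k)

lemma measure_stay_future (hX : IsMarkovChain X P Q) (hν : IsMarkovLaw X P ν)
    (W : Set S) (s t : ℝ≥0) {A : Set Ω} (hA : MeasurableSet[history X s] A) (j : S) (B : Set S) :
    ν (A ∩ {ω | X s ω = j} ∩ ({ω | ∀ u ≤ t, X (s + u) ω ∈ W} ∩ {ω | X (s + t) ω ∈ B})) =
      ν (A ∩ {ω | X s ω = j}) * P j (stay X W t ∩ {ω | X t ω ∈ B}) := by
  have hA' := hX.history_le s A hA
  have hF : MeasurableSet {ω | ∀ u ≤ t, X (s + u) ω ∈ W} := by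
    rw [← iInter_skeleton hX.rightContinuous W s t]
    exact MeasurableSet.iInter fun r => hX.measurableSet_skeleton W s _ _
  rw [← Set.inter_assoc, measure_inter_preimage hX ν ((hA'.inter (hX.measurable s j)).inter hF),
    measure_inter_preimage hX (P j) (hX.measurableSet_stay W t), ← ENNReal.tsum_mul_left]
  congr 1; ext k
  rw [Set.inter_assoc, measure_stay_future_singleton hX hν W s t hA j k]

/-! ### The Chapman–Kolmogorov equation -/

/-- The Chapman–Kolmogorov equation of the taboo probabilities. -/
lemma hasSum_taboo_add (hX : IsMarkovChain X P Q) (hν : IsMarkovLaw X P ν)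
    (W : Set S) (s t : ℝ≥0) (B : Set S) :
    HasSum (fun j => taboo X ν W s {j} * taboo X (P j) W t B) (taboo X ν W (s + t) B) := by
  have := hν.isProbabilityMeasure
  have hF : MeasurableSet {ω | ∀ u ≤ t, X (s + u) ω ∈ W} := by
    rw [← iInter_skeleton hX.rightContinuous W s t]
    exact MeasurableSet.iInter fun r => hX.measurableSet_skeleton W s _ _
  have h : ν (stay X W (s + t) ∩ {ω | X (s + t) ω ∈ B}) =
      ∑' j, ν (stay X W s ∩ {ω | X s ω = j}) * P j (stay X W t ∩ {ω | X t ω ∈ B}) := by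
    rw [measure_eq_tsum_inter hX ν ((hX.measurableSet_stay W (s + t)).inter
      (hX.measurableSet_preimage _ B)) s]
    congr 1; ext j
    rw [← measure_stay_future hX hν W s t (measurableSet_history_stay hX.rightContinuous W s) j B,
      stay_add]
    congr 1
    ext ω
    simp only [Set.mem_inter_iff]
    tauto
  have hne : ∑' j, ν (stay X W s ∩ {ω | X s ω = j}) * P j (stay X W t ∩ {ω | X t ω ∈ B}) ≠ ∞ :=
    h ▸ measure_ne_top _ _
  have h2 := ENNReal.hasSum_toReal hne
  rw [← ENNReal.tsum_toReal_eq (fun j => ENNReal.ne_top_of_tsum_ne_top hne j), ← h] at h2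
  simpa only [ENNReal.toReal_mul] using! h2

/-- Countable additivity of the taboo probabilities in the end point. -/
lemma hasSum_taboo_singleton (hX : IsMarkovChain X P Q) (hν : IsMarkovLaw X P ν)
    (W : Set S) (t : ℝ≥0) (B : Set S) :
    HasSum (fun j : B => taboo X ν W t {(j : S)}) (taboo X ν W t B) := by
  have := hν.isProbabilityMeasure
  have h := measure_inter_preimage hX ν (hX.measurableSet_stay W t) t B
  have h2 := ENNReal.hasSum_toReal (h ▸ measure_ne_top _ _)
  rw [← ENNReal.tsum_toReal_eq (fun j => measure_ne_top _ _), ← h] at h2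
  exact h2

end

/-! ### Taboo probabilities in small time -/

lemma hasDerivWithinAt_Ici_zero_iff {f : ℝ → ℝ} {f' : ℝ} :
    HasDerivWithinAt f f' (Set.Ici 0) 0 ↔
      Tendsto (fun h : ℝ => (f h - f 0) / h) (𝓝[>] 0) (𝓝 f') := by
  rw [← hasDerivWithinAt_Ioi_iff_Ici, hasDerivWithinAt_iff_tendsto_slope' (by simp)]
  have : slope f 0 = fun h : ℝ => (f h - f 0) / h := by
    ext h; simp [slope_def_field]
  rw [this]

lemma tendsto_natCast_mul_sub {f : ℝ → ℝ} {f' : ℝ} (hf : HasDerivWithinAt f f' (Set.Ici 0) 0)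
    {t : ℝ} (ht : 0 ≤ t) :
    Tendsto (fun n : ℕ => (n : ℝ) * (f (t / n) - f 0)) atTop (𝓝 (t * f')) := by
  rcases ht.eq_or_lt with rfl | ht
  · simp
  rw [hasDerivWithinAt_Ici_zero_iff] at hf
  have h1 : Tendsto (fun n : ℕ => t / (n : ℝ)) atTop (𝓝[>] 0) := by
    refine tendsto_nhdsWithin_iff.2 ⟨tendsto_const_div_atTop_nhds_zero_nat t, ?_⟩
    filter_upwards [eventually_gt_atTop 0] with n hn
    exact div_pos ht (by exact_mod_cast hn)
  refine ((hf.comp h1).const_mul t).congr' ?_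
  filter_upwards [eventually_gt_atTop 0] with n hn
  have : (n : ℝ) ≠ 0 := by exact_mod_cast hn.ne'
  simp only [Function.comp]
  field_simp

lemma toNNReal_div_natCast (t : ℝ≥0) (n : ℕ) : ((t : ℝ) / n).toNNReal = t / n := by
  rw [Real.toNNReal_div t.coe_nonneg, Real.toNNReal_coe, Real.toNNReal_natCast]

lemma tendsto_two_pow : Tendsto (fun r : ℕ => 2 ^ r) atTop (atTop : Filter ℕ) :=
  tendsto_pow_atTop_atTop_of_one_lt one_lt_two

section

variable {S Ω : Type*} [MeasurableSpace Ω] {X : ℝ≥0 → Ω → S} {P : S → Measure Ω}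
  {Q : S → S → ℝ} {ν : Measure Ω}

open Classical in
lemma transition_zero (hX : IsMarkovChain X P Q) (i j : S) :
    transition X P 0 i j = if i = j then 1 else 0 := by
  have h := taboo_zero hX (Set.mem_univ i) {j}
  simpa [taboo, stay, transition] using h

lemma rate_nonneg (hX : IsMarkovChain X P Q) {i j : S} (hij : i ≠ j) : 0 ≤ Q i j := by
  have h := hasDerivWithinAt_Ici_zero_iff.1 (hX.hasDerivWithinAt i j)
  refine ge_of_tendsto h ?_
  filter_upwards [self_mem_nhdsWithin] with u hu
  simp only [Real.toNNReal_zero, transition_zero hX, if_neg hij, sub_zero]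
  exact div_nonneg measureReal_nonneg (le_of_lt hu)

lemma rate_self_nonpos (hX : IsMarkovChain X P Q) (i : S) : Q i i ≤ 0 := by
  have h := hasDerivWithinAt_Ici_zero_iff.1 (hX.hasDerivWithinAt i i)
  refine le_of_tendsto h ?_
  filter_upwards [self_mem_nhdsWithin] with u hu
  have := hX.isProbabilityMeasure i
  simp only [Real.toNNReal_zero, transition_zero hX, if_pos]
  exact div_nonpos_of_nonpos_of_nonneg (sub_nonpos.2 measureReal_le_one) (le_of_lt hu)

variable [Countable S]

/-- `p_{ii}(t) ≥ exp (q_{ii} t)`, by supermultiplicativity of `t ↦ p_{ii}(t)`. -/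
lemma exp_le_transition_self (hX : IsMarkovChain X P Q) (i : S) (t : ℝ≥0) :
    Real.exp (Q i i * t) ≤ transition X P t i i := by
  have htab : ∀ s, transition X P s i i = taboo X (P i) Set.univ s {i} := by
    intro s; simp [taboo, stay, transition]
  have hsuper : ∀ s u, transition X P s i i * transition X P u i i ≤
      transition X P (s + u) i i := by
    intro s u
    rw [htab, htab, htab]
    exact le_hasSum (hasSum_taboo_add hX (hX.isMarkovLaw i) Set.univ s u {i}) i
      fun j _ => mul_nonneg (taboo_nonneg _ _ _ _) (taboo_nonneg _ _ _ _)
  have hpow : ∀ (s : ℝ≥0) (n : ℕ), transition X P s i i ^ n ≤ transition X P (n * s) i i := by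
    intro s n
    induction n with
    | zero => simp [transition_zero hX]
    | succ n ih =>
      have : ((n + 1 : ℕ) : ℝ≥0) * s = n * s + s := by push_cast; ring
      rw [pow_succ, this]
      exact (mul_le_mul_of_nonneg_right ih measureReal_nonneg).trans (hsuper _ _)
  have hlim := Real.tendsto_one_add_pow_exp_of_tendsto
    (tendsto_natCast_mul_sub (hX.hasDerivWithinAt i i) t.coe_nonneg)
  rw [mul_comm]
  refine le_of_tendsto hlim ?_
  filter_upwards [eventually_gt_atTop 0] with n hn
  have h := hpow (t / n) n
  rw [mul_div_cancel₀ _ (by exact_mod_cast hn.ne')] at h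
  rw [toNNReal_div_natCast, Real.toNNReal_zero, transition_zero hX, if_pos rfl]
  simpa using h

lemma sum_le_measureReal_skeleton_succ (hX : IsMarkovChain X P Q) (hν : IsMarkovLaw X P ν)
    (W : Set S) (δ : ℝ≥0) (n : ℕ) {k : S} (hk : k ∈ W) (F : Finset S) :
    ∑ l ∈ F, ν.real (skeleton X W 0 δ n ∩ {ω | X (n * δ) ω = l}) * transition X P δ l k ≤
      ν.real (skeleton X W 0 δ (n + 1) ∩ {ω | X ((n + 1 : ℕ) * δ) ω = k}) := by
  have := hν.isProbabilityMeasure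
  have h := measure_skeleton_succ hX hν W 0 δ n MeasurableSet.univ hk
  simp only [Set.univ_inter, zero_add] at h
  have h2 := ENNReal.toReal_mono (measure_ne_top _ _) ((ENNReal.sum_le_tsum F).trans h.ge)
  rw [ENNReal.toReal_sum] at h2
  · simpa only [ENNReal.toReal_mul] using! h2
  · intro l _
    have := hX.isProbabilityMeasure l
    exact ENNReal.mul_ne_top (measure_ne_top _ _) (measure_ne_top _ _)

lemma tendsto_measureReal_skeleton (hX : IsMarkovChain X P Q) (hν : IsMarkovLaw X P ν)
    (W : Set S) (t : ℝ≥0) (k : S) :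
    Tendsto (fun r : ℕ => ν.real (skeleton X W 0 (t / (2 ^ r : ℕ)) (2 ^ r) ∩
      {ω | X ((2 ^ r : ℕ) * (t / (2 ^ r : ℕ))) ω = k})) atTop (𝓝 (taboo X ν W t {k})) := by
  have := hν.isProbabilityMeasure
  have h := tendsto_measure_skeleton hX ν W 0 t MeasurableSet.univ k
  have h2 := (ENNReal.tendsto_toReal (measure_ne_top _ _)).comp h
  simp only [Set.univ_inter, zero_add] at h2
  refine h2.congr fun r => ?_
  have htime : ((2 ^ r : ℕ) : ℝ≥0) * (t / (2 ^ r : ℕ)) = t := by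
    push_cast; rw [mul_div_cancel₀ _ (by positivity)]
  rw [htime]
  push_cast
  rfl

lemma exp_le_measureReal_skeleton (hX : IsMarkovChain X P Q) {i : S} {W : Set S} (hi : i ∈ W)
    (δ : ℝ≥0) (n : ℕ) : Real.exp (Q i i * (n * δ)) ≤
      (P i).real (skeleton X W 0 δ n ∩ {ω | X (n * δ) ω = i}) := by
  induction n with
  | zero =>
    have := taboo_zero hX hi {i}
    simp only [taboo, stay, Set.mem_singleton_iff, if_true] at this
    simp only [Nat.cast_zero, zero_mul, mul_zero, Real.exp_zero, skeleton]
    rw [← this]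
    have hfin := hX.isProbabilityMeasure i
    refine measureReal_mono (fun ω hω => ⟨fun m hm => ?_, hω.2⟩)
    obtain rfl : m = 0 := by omega
    simpa using hω.1 0 le_rfl
  | succ n ih =>
    refine le_trans ?_ (sum_le_measureReal_skeleton_succ hX (hX.isMarkovLaw i) W δ n hi {i})
    rw [Finset.sum_singleton]
    refine le_trans (le_of_eq ?_)
      (mul_le_mul ih (exp_le_transition_self hX i δ) (Real.exp_nonneg _) measureReal_nonneg)
    rw [← Real.exp_add]
    congr 1; push_cast; ring

lemma exp_le_taboo_self (hX : IsMarkovChain X P Q) {i : S} {W : Set S} (hi : i ∈ W) (t : ℝ≥0) :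
    Real.exp (Q i i * t) ≤ taboo X (P i) W t {i} := by
  refine ge_of_tendsto (tendsto_measureReal_skeleton hX (hX.isMarkovLaw i) W t i)
    (Eventually.of_forall fun r => ?_)
  refine le_trans (le_of_eq ?_) (exp_le_measureReal_skeleton hX hi _ _)
  congr 2
  have : ((2 ^ r : ℕ) : ℝ) ≠ 0 := by positivity
  push_cast at this ⊢
  field_simp

/-- A lower bound for the probability of going from `i` to `j` without leaving `W ∋ i, j`. It comes
from the paths which, along a skeleton, jump only once, from `i` to `j`. -/
lemma mul_exp_le_taboo (hX : IsMarkovChain X P Q) {i j : S} (hij : i ≠ j) {W : Set S}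
    (hi : i ∈ W) (hj : j ∈ W) (t : ℝ≥0) :
    t * Q i j * Real.exp ((Q i i + Q j j) * t) ≤ taboo X (P i) W t {j} := by
  classical
  have hskel : ∀ (δ : ℝ≥0) (n : ℕ),
      n * transition X P δ i j * Real.exp ((Q i i + Q j j) * (n * δ)) ≤
        (P i).real (skeleton X W 0 δ n ∩ {ω | X (n * δ) ω = j}) := by
    intro δ n
    induction n with
    | zero => simp
    | succ n ih =>
      refine le_trans ?_
        (sum_le_measureReal_skeleton_succ hX (hX.isMarkovLaw i) W δ n hj {i, j})
      rw [Finset.sum_pair hij]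
      have hp : 0 ≤ transition X P δ i j := measureReal_nonneg
      have h1 := mul_le_mul_of_nonneg_right (exp_le_measureReal_skeleton hX hi δ n) hp
      have h2 := mul_le_mul ih (exp_le_transition_self hX j δ) (Real.exp_nonneg _)
        measureReal_nonneg
      refine le_trans ?_ (add_le_add h1 h2)
      have hqi := rate_self_nonpos hX i
      have hqj := rate_self_nonpos hX j
      have e1 : Real.exp ((Q i i + Q j j) * ((n + 1 : ℕ) * δ)) ≤ Real.exp (Q i i * (n * δ)) := by
        apply Real.exp_le_exp.2
        have ha : Q i i * (δ : ℝ) ≤ 0 := mul_nonpos_of_nonpos_of_nonneg hqi δ.coe_nonneg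
        have hb : Q j j * (((n : ℝ) + 1) * δ) ≤ 0 :=
          mul_nonpos_of_nonpos_of_nonneg hqj (by positivity)
        push_cast
        linarith
      have e2 : Real.exp ((Q i i + Q j j) * ((n + 1 : ℕ) * δ)) ≤
          Real.exp ((Q i i + Q j j) * (n * δ)) * Real.exp (Q j j * δ) := by
        rw [← Real.exp_add]
        apply Real.exp_le_exp.2
        have ha : Q i i * (δ : ℝ) ≤ 0 := mul_nonpos_of_nonpos_of_nonneg hqi δ.coe_nonneg
        push_cast
        linarith
      have e1' := mul_le_mul_of_nonneg_left e1 hp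
      have e2' := mul_le_mul_of_nonneg_left e2 (mul_nonneg (Nat.cast_nonneg n) hp)
      push_cast at e1' e2' ⊢
      linarith
  have h1 := (tendsto_natCast_mul_sub (hX.hasDerivWithinAt i j) t.coe_nonneg).comp tendsto_two_pow
  have h2 := h1.mul_const (Real.exp ((Q i i + Q j j) * t))
  refine le_of_tendsto_of_tendsto' h2
    (tendsto_measureReal_skeleton hX (hX.isMarkovLaw i) W t j) fun r => ?_
  refine le_trans (le_of_eq ?_) (hskel (t / (2 ^ r : ℕ)) (2 ^ r))
  simp only [Function.comp]
  rw [toNNReal_div_natCast, Real.toNNReal_zero, transition_zero hX, if_neg hij, sub_zero]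
  congr 3
  have : ((2 ^ r : ℕ) : ℝ) ≠ 0 := by positivity
  push_cast at this ⊢
  field_simp

end

section

variable {S Ω : Type*} [MeasurableSpace Ω] {X : ℝ≥0 → Ω → S} {P : S → Measure Ω}
  {Q : S → S → ℝ} {ν : Measure Ω}

/-- The rates out of a state into a set and its complement cancel for a conservative matrix. -/
lemma rateTo_compl (hcons : IsConservative Q) (i : S) (A : Set S) :
    rateTo Q i Aᶜ = -rateTo Q i A := by
  have h := (hcons i).summable.tsum_subtype_add_tsum_subtype_compl A
  rw [(hcons i).tsum_eq] at h
  simp only [rateTo]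
  linarith

open Classical in
/-- A lower bound for the difference quotient at `0` of the taboo probability of going from `i` to
`j` in time `h`. -/
noncomputable def smallTimeQuotient (Q : S → S → ℝ) (i j : S) (h : ℝ) : ℝ :=
  if j = i then (Real.exp (Q i i * h) - 1) / h else Q i j * Real.exp ((Q i i + Q j j) * h)

lemma abs_smallTimeQuotient_le (hX : IsMarkovChain X P Q) (i j : S) {h : ℝ} (hh : 0 < h) :
    |smallTimeQuotient Q i j h| ≤ |Q i j| := by
  have hi := rate_self_nonpos hX i
  have hj := rate_self_nonpos hX j
  unfold smallTimeQuotient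
  split_ifs with hij
  · subst hij
    rw [abs_div, abs_of_pos hh, div_le_iff₀ hh, abs_of_nonpos hi, abs_of_nonpos]
    · have := Real.add_one_le_exp (Q j j * h)
      linarith
    · rw [sub_nonpos, Real.exp_le_one_iff]
      exact mul_nonpos_of_nonpos_of_nonneg hi hh.le
  · rw [abs_mul, Real.abs_exp]
    refine mul_le_of_le_one_right (abs_nonneg _) (Real.exp_le_one_iff.2 ?_)
    exact mul_nonpos_of_nonpos_of_nonneg (by linarith) hh.le

lemma tendsto_smallTimeQuotient (Q : S → S → ℝ) (i j : S) :
    Tendsto (smallTimeQuotient Q i j) (𝓝[>] 0) (𝓝 (Q i j)) := by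
  unfold smallTimeQuotient
  split_ifs with hij
  · subst hij
    have h : HasDerivAt (fun h : ℝ => Real.exp (Q j j * h)) (Q j j) 0 := by
      simpa using ((hasDerivAt_id (0 : ℝ)).const_mul (Q j j)).exp
    have := hasDerivWithinAt_Ici_zero_iff.1 h.hasDerivWithinAt
    simpa using this
  · have h : Continuous fun h : ℝ => Q i j * Real.exp ((Q i i + Q j j) * h) := by fun_prop
    simpa using (h.tendsto 0).mono_left nhdsWithin_le_nhds

lemma tendsto_tsum_smallTimeQuotient (hX : IsMarkovChain X P Q) (hcons : IsConservative Q) (i : S)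
    (C : Set S) :
    Tendsto (fun h => ∑' j : C, smallTimeQuotient Q i j h) (𝓝[>] 0) (𝓝 (rateTo Q i C)) := by
  refine tendsto_tsum_of_dominated_convergence (bound := fun j : C => |Q i j|)
    ((hcons i).summable.abs.subtype C) (fun j => tendsto_smallTimeQuotient Q i j) ?_
  filter_upwards [self_mem_nhdsWithin] with h hh j
  exact abs_smallTimeQuotient_le hX i j hh

lemma taboo_inter (ν : Measure Ω) (W : Set S) (t : ℝ≥0) (B : Set S) :
    taboo X ν W t B = taboo X ν W t (B ∩ W) := by
  unfold taboo
  congr 1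
  ext ω
  simp only [stay, Set.mem_inter_iff, Set.mem_ofPred_eq]
  exact ⟨fun h => ⟨h.1, h.2, h.1 t le_rfl⟩, fun h => ⟨h.1, h.2.1⟩⟩

variable [Countable S]

open Classical in
lemma tsum_smallTimeQuotient_le (hX : IsMarkovChain X P Q) (hcons : IsConservative Q) {i : S}
    {C W : Set S} (hi : i ∈ W) (hC : C ⊆ W) {h : ℝ} (hh : 0 < h) :
    ∑' j : C, smallTimeQuotient Q i j h ≤
      (taboo X (P i) W h.toNNReal C - if i ∈ C then 1 else 0) / h := by
  have h1 := hasSum_taboo_singleton hX (hX.isMarkovLaw i) W h.toNNReal C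
  have h2 : HasSum (fun j : C => if (j : S) = i then (1 : ℝ) else 0) (if i ∈ C then 1 else 0) := by
    split_ifs with hiC
    · convert hasSum_ite_eq (⟨i, hiC⟩ : C) (1 : ℝ) using 3
      simp [Subtype.ext_iff]
    · convert hasSum_zero (α := ℝ) (β := C) using 2 with j
      rw [if_neg]
      rintro rfl
      exact hiC j.2
  have h3 := (h1.sub h2).div_const h
  have hs : Summable fun j : C => smallTimeQuotient Q i j h :=
    Summable.of_norm_bounded ((hcons i).summable.abs.subtype C)
      fun j => abs_smallTimeQuotient_le hX i j hh
  refine hasSum_le (fun j => ?_) hs.hasSum h3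
  rw [le_div_iff₀ hh]
  unfold smallTimeQuotient
  split_ifs with hji
  · rw [div_mul_cancel₀ _ hh.ne', hji]
    have := exp_le_taboo_self hX hi h.toNNReal
    rw [Real.coe_toNNReal _ hh.le] at this
    linarith
  · have := mul_exp_le_taboo hX (Ne.symm hji) hi (hC j.2) h.toNNReal
    rw [Real.coe_toNNReal _ hh.le] at this
    linarith

/-- The derivative at `0` of the taboo probabilities. The single-jump paths bound
`P_i(X_u ∈ W for u ≤ h, X_h ∈ B)` from below and, with `Bᶜ` in the place of `B`, from above; the two
bounds agree to first order because the rows of `Q` sum to `0`. -/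
lemma hasDerivWithinAt_taboo (hX : IsMarkovChain X P Q) (hcons : IsConservative Q) {i : S}
    {W : Set S} (hi : i ∈ W) (B : Set S) :
    HasDerivWithinAt (fun h : ℝ => taboo X (P i) W h.toNNReal B) (rateTo Q i (B ∩ W))
      (Set.Ici 0) 0 := by
  classical
  rw [hasDerivWithinAt_Ici_zero_iff]
  set C := B ∩ W
  have hC : ∀ t, taboo X (P i) W t B = taboo X (P i) W t C := fun t => taboo_inter _ W t B
  have hPi := hX.isProbabilityMeasure i
  have hlow := tendsto_tsum_smallTimeQuotient hX hcons i C
  have hup := (tendsto_tsum_smallTimeQuotient hX hcons i Cᶜ).neg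
  rw [rateTo_compl hcons, neg_neg] at hup
  refine tendsto_of_tendsto_of_tendsto_of_le_of_le' hlow hup ?_ ?_
  · filter_upwards [self_mem_nhdsWithin] with h hh
    rw [Real.toNNReal_zero, hC, hC, taboo_zero hX hi]
    exact tsum_smallTimeQuotient_le hX hcons hi Set.inter_subset_right hh
  · filter_upwards [self_mem_nhdsWithin] with h hh
    rw [Real.toNNReal_zero, hC, hC, taboo_zero hX hi]
    have h1 := tsum_smallTimeQuotient_le hX hcons (Set.mem_univ i) (Set.subset_univ Cᶜ) hh
    have h2 : taboo X (P i) W h.toNNReal C ≤ 1 - taboo X (P i) Set.univ h.toNNReal Cᶜ := by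
      have h3 := taboo_mono (X := X) (ν := P i) (Set.subset_univ W) (le_refl C) h.toNNReal
      have h4 : taboo X (P i) Set.univ h.toNNReal C + taboo X (P i) Set.univ h.toNNReal Cᶜ = 1 := by
        have := measureReal_add_measureReal_compl (μ := P i)
          (hX.measurableSet_preimage h.toNNReal C)
        simp only [taboo, stay, Set.mem_univ, implies_true]
        simpa using! this
      linarith
    rw [← neg_le_neg_iff, neg_neg]
    refine h1.trans ?_
    rw [← neg_div]
    have hh' : (0 : ℝ) < h := hh
    gcongr
    by_cases hiC : i ∈ C
    · simp [hiC] at h2 ⊢; linarith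
    · simp [hiC] at h2 ⊢; linarith

/-- The derivative at `0` of the probability of leaving `W`. -/
lemma hasDerivWithinAt_exit (hX : IsMarkovChain X P Q) (hcons : IsConservative Q) {i : S}
    {W : Set S} (hi : i ∈ W) :
    HasDerivWithinAt (fun h : ℝ => 1 - taboo X (P i) W h.toNNReal Set.univ) (rateTo Q i Wᶜ)
      (Set.Ici 0) 0 := by
  rw [rateTo_compl hcons]
  simpa using (hasDerivWithinAt_taboo hX hcons hi Set.univ).const_sub 1

end

/-! ### First-passage bounds -/

section

variable {S Ω κ : Type*} [MeasurableSpace Ω] {X : ℝ≥0 → Ω → S} {P : S → Measure Ω}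
  {Q : S → S → ℝ} {ν : Measure Ω}

lemma ae_finite_range (hX : IsMarkovChain X P Q) (hne : IsNonexplosive X P) (i : S) (t : ℝ≥0) :
    ∀ᵐ ω ∂(P i), ((fun u => X u ω) '' Set.Iic t).Finite := by
  filter_upwards [hne i] with ω hω
  exact finite_image_Iic (hX.rightContinuous ω) (hω t)

/-- Paths with finite range see only finitely many classes. -/
lemma tendsto_taboo_finset [Countable κ] [IsFiniteMeasure ν] {t : ℝ≥0}
    (hfin : ∀ᵐ ω ∂ν, ((fun u => X u ω) '' Set.Iic t).Finite) (c : S → κ) (W B : Set S) :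
    Tendsto (fun K : Finset κ => taboo X ν (W ∩ c ⁻¹' K) t B) atTop (𝓝 (taboo X ν W t B)) := by
  have hmono : Monotone fun K : Finset κ => stay X (W ∩ c ⁻¹' K) t ∩ {ω | X t ω ∈ B} := by
    intro K K' h
    refine Set.inter_subset_inter_left _ (stay_mono ?_ t)
    exact Set.inter_subset_inter_right _ (Set.preimage_mono (by exact_mod_cast h))
  have h := tendsto_measure_iUnion_atTop (μ := ν) hmono
  have heq : ν (⋃ K : Finset κ, stay X (W ∩ c ⁻¹' K) t ∩ {ω | X t ω ∈ B}) =
      ν (stay X W t ∩ {ω | X t ω ∈ B}) := by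
    refine measure_congr ?_
    filter_upwards [hfin] with ω hω
    apply propext
    constructor
    · intro h
      obtain ⟨K, h1, h2⟩ := Set.mem_iUnion.1 h
      exact ⟨stay_mono Set.inter_subset_left t h1, h2⟩
    · rintro ⟨h1, h2⟩
      refine Set.mem_iUnion.2 ⟨(hω.image c).toFinset, fun u hu => ⟨h1 u hu, ?_⟩, h2⟩
      simp only [Set.mem_preimage, Set.Finite.coe_toFinset]
      exact ⟨_, ⟨u, hu, rfl⟩, rfl⟩
  rw [heq] at h
  exact (ENNReal.tendsto_toReal (measure_ne_top _ _)).comp h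

variable [Countable S]

lemma ae_startFrom_of_forall (μ : PMF S) {p : Ω → Prop} (h : ∀ i ∈ μ.support, ∀ᵐ ω ∂(P i), p ω) :
    ∀ᵐ ω ∂(startFrom P μ), p ω := by
  rw [startFrom, Measure.ae_sum_iff]
  intro i
  by_cases hi : μ i = 0
  · simp [hi]
  · exact Measure.ae_smul_measure (h i ((PMF.mem_support_iff _ _).2 hi)) _

/-- The probability of having stayed in `W` up to time `s`, with `X_s ∈ V`, and of leaving `W` before
time `s + t`. -/
lemma hasSum_exit (hX : IsMarkovChain X P Q) (hν : IsMarkovLaw X P ν) (W V : Set S) (s t : ℝ≥0) :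
    HasSum (fun j : V => taboo X ν W s {(j : S)} * (1 - taboo X (P j) W t Set.univ))
      (ν.real ((stay X W s ∩ {ω | X s ω ∈ V}) \ stay X W (s + t))) := by
  have := hν.isProbabilityMeasure
  have hG : MeasurableSet (stay X W s \ stay X W (s + t)) :=
    (hX.measurableSet_stay W s).diff (hX.measurableSet_stay W (s + t))
  have h := measure_inter_preimage hX ν hG s V
  have h2 := ENNReal.hasSum_toReal (h ▸ measure_ne_top _ _)
  rw [← ENNReal.tsum_toReal_eq (fun j => measure_ne_top _ _), ← h] at h2
  convert! h2 using 1
  · ext j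
    have h3 := measure_stay_future hX hν W s t
      (measurableSet_history_stay hX.rightContinuous W s) j Set.univ
    have h4 : (stay X W s \ stay X W (s + t)) ∩ {ω | X s ω = j} =
        (stay X W s ∩ {ω | X s ω = j}) \ (stay X W s ∩ {ω | X s ω = j} ∩
          ({ω | ∀ u ≤ t, X (s + u) ω ∈ W} ∩ {ω | X (s + t) ω ∈ Set.univ})) := by
      rw [stay_add]
      ext ω
      simp only [Set.mem_inter_iff, Set.mem_sdiff, Set.mem_univ, Set.mem_ofPred_eq]
      tauto
    have hF : MeasurableSet {ω | ∀ u ≤ t, X (s + u) ω ∈ W} := by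
      rw [← iInter_skeleton hX.rightContinuous W s t]
      exact MeasurableSet.iInter fun r => hX.measurableSet_skeleton W s _ _
    rw [h4, ← measureReal_def, measureReal_sdiff Set.inter_subset_left
      (((hX.measurableSet_stay W s).inter (hX.measurable s j)).inter
        (hF.inter (hX.measurableSet_preimage _ _))), measureReal_def ν (_ ∩ (_ ∩ _)), h3,
      ENNReal.toReal_mul]
    simp only [taboo, measureReal_def, Set.mem_singleton_iff]
    ring
  · rw [measureReal_def]
    congr 2
    ext ω
    simp only [Set.mem_inter_iff, Set.mem_sdiff]
    tauto

/-- If a path starting in `W` leaves `W` before `t`, but visits only the classes in `K` before doing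
so, then it leaves `W` from one of these classes in one of the `N` time steps of length `t / N`. -/
lemma exit_le_sum (hX : IsMarkovChain X P Q) (hν : IsMarkovLaw X P ν) {W : Set S} (V : Set S)
    (hstart : ∀ᵐ ω ∂ν, X 0 ω ∈ W) (t : ℝ≥0) {N : ℕ} (hN : N ≠ 0) :
    1 - taboo X ν W t Set.univ ≤ (1 - taboo X ν (V ∪ Wᶜ) t Set.univ) +
      ∑ m ∈ Finset.range N, ν.real ((stay X W (m * (t / N)) ∩ {ω | X (m * (t / N)) ω ∈ V}) \
        stay X W (m * (t / N) + t / N)) := by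
  have := hν.isProbabilityMeasure
  have hcompl : ∀ U : Set S, 1 - taboo X ν U t Set.univ = ν.real (stay X U t)ᶜ := by
    intro U
    rw [probReal_compl_eq_one_sub (hX.measurableSet_stay U t)]
    simp [taboo]
  rw [hcompl, hcompl]
  set R : ℕ → Set Ω := fun m => (stay X W (m * (t / N)) ∩ {ω | X (m * (t / N)) ω ∈ V}) \
        stay X W (m * (t / N) + t / N) with hR
  have hsub : ∀ᵐ ω ∂ν, ω ∈ (stay X W t)ᶜ →
      ω ∈ (stay X (V ∪ Wᶜ) t)ᶜ ∪ ⋃ m ∈ Finset.range N, R m := by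
    filter_upwards [hstart] with ω h0 hW
    by_contra hcon
    rw [Set.mem_union, not_or, Set.notMem_compl_iff] at hcon
    obtain ⟨hV, hRn⟩ := hcon
    simp only [Set.mem_iUnion, not_exists] at hRn
    have hall : ∀ m ≤ N, ω ∈ stay X W (m * (t / N)) := by
      intro m hm
      induction m with
      | zero =>
        intro u hu
        obtain rfl : u = 0 := le_antisymm (by simpa using hu) bot_le
        exact h0
      | succ m ih =>
        have ih := ih (by omega)
        have hmt : (m : ℝ≥0) * (t / N) ≤ t := by
          have : (m : ℝ≥0) ≤ N := by exact_mod_cast (by omega : m ≤ N)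
          calc (m : ℝ≥0) * (t / N) ≤ N * (t / N) := by gcongr
            _ = t := mul_div_cancel₀ _ (by exact_mod_cast hN)
        have h1 : X (m * (t / N)) ω ∈ V := by
          rcases hV _ hmt with h | h
          · exact h
          · exact absurd (ih _ le_rfl) h
        have h2 := hRn m (Finset.mem_range.2 (by omega))
        by_contra h3
        apply h2
        refine ⟨⟨ih, h1⟩, ?_⟩
        have : ((m + 1 : ℕ) : ℝ≥0) * (t / N) = m * (t / N) + t / N := by push_cast; ring
        rwa [← this]
    have := hall N le_rfl
    rw [mul_div_cancel₀ _ (by exact_mod_cast hN)] at this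
    exact hW this
  calc ν.real (stay X W t)ᶜ ≤ ν.real ((stay X (V ∪ Wᶜ) t)ᶜ ∪ ⋃ m ∈ Finset.range N, R m) :=
        ENNReal.toReal_mono (measure_ne_top _ _) (measure_mono_ae hsub)
    _ ≤ ν.real (stay X (V ∪ Wᶜ) t)ᶜ + ν.real (⋃ m ∈ Finset.range N, R m) :=
        measureReal_union_le _ _
    _ ≤ _ := by
        gcongr
        exact measureReal_biUnion_finset_le _ _

/-- Grouping the states of `W` by the value of `c`. -/
lemma hasSum_taboo_fiber (hX : IsMarkovChain X P Q) (hν : IsMarkovLaw X P ν) (c : S → κ)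
    (W : Set S) (t : ℝ≥0) {φ : κ → ℝ} {x : ℝ}
    (h : HasSum (fun j => taboo X ν W t {j} * φ (c j)) x) :
    HasSum (fun k => taboo X ν W t (c ⁻¹' {k}) * φ k) x := by
  rw [← (Equiv.sigmaFiberEquiv c).hasSum_iff] at h
  refine h.sigma fun k => ?_
  have h1 : HasSum (fun j : {x // c x = k} => taboo X ν W t {(j : S)})
      (taboo X ν W t (c ⁻¹' {k})) := hasSum_taboo_singleton hX hν W t (c ⁻¹' {k})
  change HasSum (fun j : {x // c x = k} => taboo X ν W t {(j : S)} * φ (c j)) _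
  have h2 : (fun j : {x // c x = k} => taboo X ν W t {(j : S)} * φ (c j)) =
      fun j : {x // c x = k} => taboo X ν W t {(j : S)} * φ k := by
    funext j; rw [j.2]
  rw [h2]
  exact h1.mul_right (φ k)

/-- The sum of `hasSum_exit` by classes, when the probability of leaving `W` depends only on the class
of the initial state. -/
lemma exit_real_eq_sum (hX : IsMarkovChain X P Q) (hν : IsMarkovLaw X P ν) (W : Set S)
    (c : S → κ) (K : Finset κ) (v : κ → ℝ) (s δ : ℝ≥0)
    (hv : ∀ j ∈ W, c j ∈ K → 1 - taboo X (P j) W δ Set.univ = v (c j)) :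
    ν.real ((stay X W s ∩ {ω | X s ω ∈ c ⁻¹' K}) \ stay X W (s + δ)) =
      ∑ k ∈ K, taboo X ν W s (c ⁻¹' {k}) * v k := by
  classical
  have h := hasSum_exit hX hν W (c ⁻¹' K) s δ
  have h2 : HasSum (fun j => taboo X ν W s {j} * (if c j ∈ K then v (c j) else 0))
      (ν.real ((stay X W s ∩ {ω | X s ω ∈ c ⁻¹' K}) \ stay X W (s + δ))) := by
    rw [← hasSum_subtype_iff_of_support_subset (s := c ⁻¹' (K : Set κ))]
    · convert! h using 2 with j
      simp only [Function.comp]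
      have hjK : c j ∈ K := j.2
      rw [if_pos hjK]
      by_cases hj : (j : S) ∈ W
      · rw [hv j hj hjK]
      · rw [taboo_eq_zero_of_disjoint (Set.disjoint_singleton_right.2 hj)]; simp
    · intro j hj
      by_contra hjK
      apply hj
      have : c j ∉ K := hjK
      simp [this]
  have h3 := hasSum_taboo_fiber hX hν c W s (φ := fun k => if k ∈ K then v k else 0) h2
  have h4 : HasSum (fun k => taboo X ν W s (c ⁻¹' {k}) * if k ∈ K then v k else 0)
      (∑ k ∈ K, taboo X ν W s (c ⁻¹' {k}) * if k ∈ K then v k else 0) :=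
    hasSum_sum_of_ne_finset_zero fun k hk => by simp [hk]
  rw [h3.unique h4]
  exact Finset.sum_congr rfl fun k hk => by rw [if_pos hk]

/-- If the rates of leaving `W` from the classes of states add up, along the taboo probabilities, to
at most `ρ`, then the probability of leaving `W` before time `t` is at most `t ρ`. Nonexplosion
enters through the finiteness of the range of the paths, without which `W` could be left after
infinitely many jumps. -/
lemma exit_le [Countable κ] (hX : IsMarkovChain X P Q) (hν : IsMarkovLaw X P ν) {W : Set S}
    (hstart : ∀ᵐ ω ∂ν, X 0 ω ∈ W) {t : ℝ≥0}
    (hfin : ∀ᵐ ω ∂ν, ((fun u => X u ω) '' Set.Iic t).Finite) (c : S → κ) (v : κ → ℝ≥0 → ℝ)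
    (r : κ → ℝ) {ρ : ℝ} (hv : ∀ j ∈ W, ∀ δ, 1 - taboo X (P j) W δ Set.univ = v (c j) δ)
    (hr : ∀ k ∈ c '' W, Tendsto (fun n : ℕ => n * v k (t / n)) atTop (𝓝 (t * r k)))
    (hρ : ∀ s ≤ t, ∀ K : Finset κ, (K : Set κ) ⊆ c '' W →
      ∑ k ∈ K, taboo X ν W s (c ⁻¹' {k}) * r k ≤ ρ) :
    1 - taboo X ν W t Set.univ ≤ t * ρ := by
  classical
  have := hν.isProbabilityMeasure
  have hK : ∀ K : Finset κ, 1 - taboo X ν W t Set.univ ≤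
      (1 - taboo X ν (Set.univ ∩ c ⁻¹' K) t Set.univ) + t * ρ := by
    intro K
    set L := K.filter (· ∈ c '' W) with hL
    have hLW : ∀ k ∈ L, k ∈ c '' W := fun k hk => (Finset.mem_filter.1 hk).2
    have hLK : taboo X ν (Set.univ ∩ c ⁻¹' K) t Set.univ ≤
        taboo X ν (c ⁻¹' L ∪ Wᶜ) t Set.univ := by
      refine taboo_mono (fun j hj => ?_) le_rfl t
      by_cases hjW : j ∈ W
      · exact Or.inl (Finset.mem_coe.2 (Finset.mem_filter.2 ⟨hj.2, j, hjW, rfl⟩))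
      · exact Or.inr hjW
    have hN : ∀ N : ℕ, N ≠ 0 → 1 - taboo X ν W t Set.univ ≤
        (1 - taboo X ν (c ⁻¹' L ∪ Wᶜ) t Set.univ) +
          (t * ρ + ∑ k ∈ L, |N * v k (t / N) - t * r k|) := by
      intro N hN
      have hN' : (0 : ℝ) < N := by exact_mod_cast Nat.pos_of_ne_zero hN
      refine (exit_le_sum hX hν (c ⁻¹' L) hstart t hN).trans ?_
      gcongr
      have hstep : ∀ m ∈ Finset.range N,
          ν.real ((stay X W (m * (t / N)) ∩ {ω | X (m * (t / N)) ω ∈ c ⁻¹' L}) \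
            stay X W (m * (t / N) + t / N)) ≤
          (t * ρ + ∑ k ∈ L, |N * v k (t / N) - t * r k|) / N := by
        intro m hm
        rw [exit_real_eq_sum hX hν W c L (fun k => v k (t / N)) _ _ (fun j hj _ => hv j hj _),
          le_div_iff₀ hN']
        have hmt : (m : ℝ≥0) * (t / N) ≤ t := by
          have : (m : ℝ≥0) ≤ N := by exact_mod_cast (Finset.mem_range.1 hm).le
          calc (m : ℝ≥0) * (t / N) ≤ N * (t / N) := by gcongr
            _ = t := mul_div_cancel₀ _ (by exact_mod_cast hN)
        have h1 := mul_le_mul_of_nonneg_left (hρ _ hmt L (fun k hk => hLW k hk)) t.coe_nonneg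
        have h2 : ∑ k ∈ L, taboo X ν W (m * (t / N)) (c ⁻¹' {k}) * (N * v k (t / N) - t * r k) ≤
            ∑ k ∈ L, |N * v k (t / N) - t * r k| := by
          refine Finset.sum_le_sum fun k _ => ?_
          have h01 : taboo X ν W (m * (t / N)) (c ⁻¹' {k}) ≤ 1 := measureReal_le_one
          calc _ ≤ taboo X ν W (m * (t / N)) (c ⁻¹' {k}) * |N * v k (t / N) - t * r k| :=
                mul_le_mul_of_nonneg_left (le_abs_self _) (taboo_nonneg _ _ _ _)
            _ ≤ _ := mul_le_of_le_one_left (abs_nonneg _) h01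
        refine le_trans (le_of_eq ?_) (add_le_add h1 h2)
        rw [Finset.sum_mul, Finset.mul_sum, ← Finset.sum_add_distrib]
        exact Finset.sum_congr rfl fun k _ => by ring
      refine (Finset.sum_le_card_nsmul _ _ _ hstep).trans (le_of_eq ?_)
      rw [Finset.card_range, nsmul_eq_mul, mul_div_cancel₀ _ hN'.ne']
    have hlim : Tendsto (fun N : ℕ => (1 - taboo X ν (c ⁻¹' L ∪ Wᶜ) t Set.univ) +
          (t * ρ + ∑ k ∈ L, |N * v k (t / N) - t * r k|)) atTop
        (𝓝 ((1 - taboo X ν (c ⁻¹' L ∪ Wᶜ) t Set.univ) + (t * ρ + ∑ k ∈ L, 0))) := by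
      refine Tendsto.const_add _ (Tendsto.const_add _ (tendsto_finsetSum _ fun k hk => ?_))
      have := ((hr k (hLW k hk)).sub_const (t * r k)).abs
      simpa using this
    have := ge_of_tendsto hlim ((eventually_ne_atTop 0).mono hN)
    simp only [Finset.sum_const_zero, add_zero] at this
    linarith
  have hlim := tendsto_taboo_finset hfin c Set.univ Set.univ
  have huniv : taboo X ν Set.univ t Set.univ = 1 := by simp [taboo, stay]
  rw [huniv] at hlim
  have := ge_of_tendsto' ((hlim.const_sub 1).add_const (t * ρ)) hK
  simpa using this

end

/-! ### Blocks and lumped rates -/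

section

variable {S ι : Type*}

/-- The index of the block of a state. -/
noncomputable def BlockPartition.index (E : BlockPartition S ι) (j : S) : ι :=
  (Set.mem_iUnion.1 (E.cover.symm ▸ Set.mem_univ j : j ∈ ⋃ k, E.block k)).choose

lemma BlockPartition.mem_block_iff (E : BlockPartition S ι) {j : S} {k : ι} :
    j ∈ E.block k ↔ E.index j = k := by
  have h : j ∈ E.block (E.index j) :=
    (Set.mem_iUnion.1 (E.cover.symm ▸ Set.mem_univ j : j ∈ ⋃ k, E.block k)).choose_spec
  constructor
  · intro hk
    by_contra hne
    exact Set.disjoint_left.1 (E.disjoint hne) h hk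
  · rintro rfl
    exact h

lemma BlockPartition.block_eq_preimage (E : BlockPartition S ι) (k : ι) :
    E.block k = E.index ⁻¹' {k} := by
  ext j; exact E.mem_block_iff

/-- A chosen state of the block `k`, the one used in `blockRate`. -/
noncomputable def BlockPartition.rep (E : BlockPartition S ι) (k : ι) : S := (E.nonempty k).some

lemma BlockPartition.index_rep (E : BlockPartition S ι) (k : ι) : E.index (E.rep k) = k :=
  E.mem_block_iff.1 (E.nonempty k).some_mem

lemma BlockPartition.countable_index [Countable S] (E : BlockPartition S ι) : Countable ι :=
  Function.Surjective.countable (f := E.index) fun k => ⟨E.rep k, E.index_rep k⟩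

variable {Q : S → S → ℝ}

lemma hasSum_rateTo_block (hcons : IsConservative Q) (E : BlockPartition S ι) (i : S) :
    HasSum (fun l => rateTo Q i (E.block l)) 0 := by
  have h := hcons i
  rw [← (Equiv.sigmaFiberEquiv E.index).hasSum_iff] at h
  refine h.sigma fun l => ?_
  rw [E.block_eq_preimage]
  exact ((hcons i).summable.subtype (E.index ⁻¹' {l})).hasSum

variable {E : BlockPartition S ι} {o : ι}

/-- The rates of a state between the blocks are given by the lumped matrix, including on the
diagonal. -/
lemma rateTo_block (hcons : IsConservative Q) (hlump : IsLumpable Q E o) {i : S}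
    (hi : E.index i ≠ o) (l : ι) :
    rateTo Q i (E.block l) = lumpedMatrix Q E o (E.index i) l := by
  classical
  set k := E.index i with hk
  have hoff : ∀ l, l ≠ k → rateTo Q i (E.block l) = blockRate Q E k l := fun l hl =>
    hlump k l hi hl i (E.mem_block_iff.2 rfl) _ (E.nonempty k).some_mem
  unfold lumpedMatrix
  rw [if_neg hi]
  split_ifs with hl
  · subst hl
    have h := hasSum_rateTo_block hcons E i
    have h1 := h.summable.tsum_subtype_add_tsum_subtype_compl {E.index i}
    rw [h.tsum_eq, tsum_singleton (E.index i) (fun l => rateTo Q i (E.block l))] at h1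
    have h2 : ∑' m : {m : ι // m ≠ E.index i}, blockRate Q E (E.index i) m =
        ∑' m : ({E.index i}ᶜ : Set ι), rateTo Q i (E.block m) :=
      tsum_congr fun m => (hoff m m.2).symm
    rw [h2]
    linarith
  · exact hoff l hl

lemma hasSum_lumpedMatrix (hcons : IsConservative Q) (hlump : IsLumpable Q E o) (k : ι) :
    HasSum (lumpedMatrix Q E o k) 0 := by
  by_cases hk : k = o
  · have : lumpedMatrix Q E o k = fun _ => 0 := by ext l; simp [lumpedMatrix, hk]
    rw [this]; exact hasSum_zero
  · have h := hasSum_rateTo_block hcons E (E.rep k)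
    have hk' : E.index (E.rep k) ≠ o := by rwa [E.index_rep]
    convert! h using 1
    ext l
    rw [rateTo_block hcons hlump hk', E.index_rep]

lemma rateTo_compl_block (hcons : IsConservative Q) (hlump : IsLumpable Q E o) {i : S}
    (hi : E.index i ≠ o) :
    rateTo Q i (E.block (E.index i))ᶜ = -lumpedMatrix Q E o (E.index i) (E.index i) := by
  rw [rateTo_compl hcons, rateTo_block hcons hlump hi]

lemma lumpedMatrix_self_row (Q : S → S → ℝ) (E : BlockPartition S ι) (o l : ι) :
    lumpedMatrix Q E o o l = 0 := by
  simp [lumpedMatrix]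

lemma lumpedMatrix_nonneg {Ω : Type*} [MeasurableSpace Ω] {X : ℝ≥0 → Ω → S} {P : S → Measure Ω}
    (hX : IsMarkovChain X P Q) {k l : ι} (hkl : l ≠ k) : 0 ≤ lumpedMatrix Q E o k l := by
  unfold lumpedMatrix
  split_ifs
  · exact le_rfl
  · refine tsum_nonneg fun j => rate_nonneg hX ?_
    intro h
    have h1 := E.mem_block_iff.1 (E.nonempty k).some_mem
    have h2 := E.mem_block_iff.1 j.2
    rw [← h, h1] at h2
    exact hkl h2.symm

/-- The union of the blocks with index in `K`, without the block `o`. -/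
def region (E : BlockPartition S ι) (o : ι) (K : Finset ι) : Set S :=
  (E.block o)ᶜ ∩ E.index ⁻¹' K

lemma mem_region {K : Finset ι} {j : S} : j ∈ region E o K ↔ E.index j ≠ o ∧ E.index j ∈ K := by
  simp [region, E.mem_block_iff]

lemma block_subset_region {K : Finset ι} {k : ι} (hk : k ∈ K) (hko : k ≠ o) :
    E.block k ⊆ region E o K := by
  intro j hj
  rw [E.mem_block_iff] at hj
  rw [mem_region, hj]
  exact ⟨hko, hk⟩

end

/-! ### The lumped forward equation in finitely many blocks -/

section

variable {S Ω ι : Type*} [MeasurableSpace Ω] {X : ℝ≥0 → Ω → S} {P : S → Measure Ω}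
  {Q : S → S → ℝ} {ν : Measure Ω} {E : BlockPartition S ι} {o : ι}

lemma hasDerivWithinAt_Ici_of_shift {f : ℝ → ℝ} {f' x : ℝ}
    (h : HasDerivWithinAt (fun h => f (x + h)) f' (Set.Ici 0) 0) :
    HasDerivWithinAt f f' (Set.Ici x) x := by
  have h1 : HasDerivWithinAt (fun y : ℝ => y - x) 1 (Set.Ici x) x :=
    (hasDerivWithinAt_id x _).sub_const x
  have h2 : HasDerivWithinAt (fun h => f (x + h)) f' (Set.Ici 0) (x - x) := by simpa using h
  have h3 := HasDerivWithinAt.comp (h := fun y : ℝ => y - x) x h2 h1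
    (fun y hy => by simpa using hy)
  simpa [Function.comp_def] using h3

/-- A bound for the rates of leaving the blocks of `K`. -/
noncomputable def exitBound (Q : S → S → ℝ) (E : BlockPartition S ι) (o : ι) (K : Finset ι) : ℝ :=
  ∑ k ∈ K, |lumpedMatrix Q E o k k|

lemma exitBound_nonneg (Q : S → S → ℝ) (E : BlockPartition S ι) (o : ι) (K : Finset ι) :
    0 ≤ exitBound Q E o K := Finset.sum_nonneg fun _ _ => abs_nonneg _

variable [Countable S]

open Classical in
lemma hasSum_taboo_ite (hX : IsMarkovChain X P Q) (hν : IsMarkovLaw X P ν) (W : Set S) (t : ℝ≥0)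
    (B : Set S) :
    HasSum (fun j => taboo X ν W t {j} * if j ∈ B then 1 else 0) (taboo X ν W t B) := by
  have h := (hasSum_subtype_iff_indicator (f := fun j => taboo X ν W t {j})).1
    (hasSum_taboo_singleton hX hν W t B)
  convert! h using 1
  ext j
  by_cases hj : j ∈ B <;> simp [hj]

/-- A state of the block `k` leaves the block before time `t` with probability at most `t` times
the lumped rate of leaving `k`. The bound is uniform over the block although the rates of its states
need not be bounded. -/
lemma exit_block_le (hX : IsMarkovChain X P Q) (hcons : IsConservative Q) (hne : IsNonexplosive X P)
    (hlump : IsLumpable Q E o) {i : S} (hi : E.index i ≠ o) (t : ℝ≥0) :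
    1 - taboo X (P i) (E.block (E.index i)) t Set.univ ≤
      t * -lumpedMatrix Q E o (E.index i) (E.index i) := by
  set k := E.index i with hk
  set W := E.block k
  have hPi := hX.isProbabilityMeasure i
  have hstart : ∀ᵐ ω ∂(P i), X 0 ω ∈ W := by
    have h : ∀ᵐ ω ∂(P i), X 0 ω = i :=
      (prob_compl_eq_zero_iff (hX.measurable 0 i)).2 (hX.start i)
    filter_upwards [h] with ω hω
    rw [hω]; exact E.mem_block_iff.2 rfl
  have hrate : ∀ j ∈ W, rateTo Q j Wᶜ = -lumpedMatrix Q E o k k := by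
    intro j hj
    have hjk := E.mem_block_iff.1 hj
    have := rateTo_compl_block hcons hlump (i := j) (by rwa [hjk])
    rwa [hjk] at this
  refine exit_le hX (hX.isMarkovLaw i) hstart (ae_finite_range hX hne i t) id
    (fun j δ => 1 - taboo X (P j) W δ Set.univ) (fun _ => -lumpedMatrix Q E o k k)
    (fun j _ δ => rfl) ?_ ?_
  · intro j hj
    rw [Set.image_id] at hj
    have h := tendsto_natCast_mul_sub (hasDerivWithinAt_exit hX hcons hj) t.coe_nonneg
    rw [hrate j hj] at h
    refine h.congr fun n => ?_
    rw [toNNReal_div_natCast, Real.toNNReal_zero, taboo_zero hX hj]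
    simp
  · intro s _ K _
    rw [← Finset.sum_mul]
    refine mul_le_of_le_one_left ?_ ?_
    · rw [← hrate i (E.mem_block_iff.2 rfl)]
      refine tsum_nonneg fun j => rate_nonneg hX ?_
      intro hij
      exact j.2 (E.mem_block_iff.2 (by rw [← hij]))
    · have h := hasSum_taboo_ite hX (hX.isMarkovLaw i) W s Set.univ
      simp only [Set.mem_univ, if_true, mul_one] at h
      exact (sum_le_hasSum K (fun j _ => taboo_nonneg _ _ _ _) h).trans measureReal_le_one

open Classical in
lemma abs_taboo_sub_le (hX : IsMarkovChain X P Q) (hcons : IsConservative Q)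
    (hne : IsNonexplosive X P) (hlump : IsLumpable Q E o) {i : S} (hi : E.index i ≠ o) {W : Set S}
    (hW : E.block (E.index i) ⊆ W) (t : ℝ≥0) (l : ι) :
    |taboo X (P i) W t (E.block l) - if i ∈ E.block l then 1 else 0| ≤
      t * -lumpedMatrix Q E o (E.index i) (E.index i) := by
  have hPi := hX.isProbabilityMeasure i
  refine le_trans ?_ (exit_block_le hX hcons hne hlump hi t)
  have hself : taboo X (P i) (E.block (E.index i)) t Set.univ =
      taboo X (P i) (E.block (E.index i)) t (E.block (E.index i)) := by
    rw [taboo_inter, Set.univ_inter]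
  split_ifs with hl
  · rw [E.mem_block_iff] at hl
    subst hl
    rw [abs_sub_comm, abs_of_nonneg (sub_nonneg.2 (taboo_le_one _ _ _ _)), hself]
    exact sub_le_sub_left (taboo_mono hW le_rfl t) 1
  · rw [sub_zero, abs_of_nonneg (taboo_nonneg _ _ _ _), le_sub_iff_add_le', hself]
    rw [E.mem_block_iff] at hl
    have hdisj : Disjoint (stay X (E.block (E.index i)) t ∩ {ω | X t ω ∈ E.block (E.index i)})
        (stay X W t ∩ {ω | X t ω ∈ E.block l}) :=
      Set.disjoint_left.2 fun ω h1 h2 => Set.disjoint_left.1 (E.disjoint hl) h1.2 h2.2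
    unfold taboo
    rw [← measureReal_union hdisj ((hX.measurableSet_stay _ _).inter
      (hX.measurableSet_preimage _ _))]
    exact measureReal_le_one

open Classical in
lemma hasSum_taboo_sub (hX : IsMarkovChain X P Q) (hν : IsMarkovLaw X P ν) (W B : Set S)
    (t h : ℝ≥0) :
    HasSum (fun j => taboo X ν W t {j} * (taboo X (P j) W h B - if j ∈ B then 1 else 0))
      (taboo X ν W (t + h) B - taboo X ν W t B) := by
  convert! (hasSum_taboo_add hX hν W t h B).sub (hasSum_taboo_ite hX hν W t B) using 1
  ext j; ring

open Classical in
/-- The domination behind the forward equation. -/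
lemma norm_taboo_mul_sub_le (hX : IsMarkovChain X P Q) (hcons : IsConservative Q)
    (hne : IsNonexplosive X P) (hlump : IsLumpable Q E o) (K : Finset ι) (l : ι)
    (t h : ℝ≥0) (j : S) :
    |taboo X ν (region E o K) t {j} * (taboo X (P j) (region E o K) h (E.block l) -
      if j ∈ E.block l then 1 else 0)| ≤
      taboo X ν (region E o K) t {j} * (h * exitBound Q E o K) := by
  rw [abs_mul, abs_of_nonneg (taboo_nonneg _ _ _ _)]
  by_cases hj : j ∈ region E o K
  · refine mul_le_mul_of_nonneg_left ?_ (taboo_nonneg _ _ _ _)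
    rw [mem_region] at hj
    refine (abs_taboo_sub_le hX hcons hne hlump hj.1 (block_subset_region hj.2 hj.1) h l).trans ?_
    refine mul_le_mul_of_nonneg_left ?_ h.coe_nonneg
    exact (neg_le_abs _).trans (Finset.single_le_sum (f := fun k => |lumpedMatrix Q E o k k|)
      (fun k _ => abs_nonneg _) hj.2)
  · rw [taboo_eq_zero_of_disjoint (Set.disjoint_singleton_right.2 hj)]; simp

lemma abs_taboo_add_sub_le (hX : IsMarkovChain X P Q) (hν : IsMarkovLaw X P ν)
    (hcons : IsConservative Q) (hne : IsNonexplosive X P) (hlump : IsLumpable Q E o)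
    (K : Finset ι) (l : ι) (t h : ℝ≥0) :
    |taboo X ν (region E o K) (t + h) (E.block l) - taboo X ν (region E o K) t (E.block l)| ≤
      h * exitBound Q E o K := by
  classical
  have := hν.isProbabilityMeasure
  have h1 := hasSum_taboo_sub hX hν (region E o K) (E.block l) t h
  have h2 := hasSum_taboo_ite hX hν (region E o K) t Set.univ
  simp only [Set.mem_univ, if_true, mul_one] at h2
  have h3 := h2.mul_right (h * exitBound Q E o K)
  have h4 := norm_taboo_mul_sub_le (ν := ν) hX hcons hne hlump K l t h
  have h5 : taboo X ν (region E o K) t Set.univ * (h * exitBound Q E o K) ≤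
      h * exitBound Q E o K :=
    mul_le_of_le_one_left (mul_nonneg h.coe_nonneg (exitBound_nonneg Q E o K)) measureReal_le_one
  rw [abs_le]
  constructor
  · have := hasSum_le (fun j => neg_le_of_abs_le (h4 j)) h3.neg h1
    linarith
  · have := hasSum_le (fun j => le_of_abs_le (h4 j)) h1 h3
    linarith

lemma continuous_taboo_region (hX : IsMarkovChain X P Q) (hν : IsMarkovLaw X P ν)
    (hcons : IsConservative Q) (hne : IsNonexplosive X P) (hlump : IsLumpable Q E o)
    (K : Finset ι) (l : ι) :
    Continuous fun t : ℝ => taboo X ν (region E o K) t.toNNReal (E.block l) := by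
  have hlip : LipschitzWith (exitBound Q E o K).toNNReal
      fun t : ℝ≥0 => taboo X ν (region E o K) t (E.block l) := by
    refine LipschitzWith.of_dist_le_mul fun s t => ?_
    rw [Real.coe_toNNReal _ (exitBound_nonneg Q E o K)]
    wlog hst : s ≤ t generalizing s t
    · rw [dist_comm, dist_comm s]
      exact this t s (le_of_not_ge hst)
    have h := abs_taboo_add_sub_le hX hν hcons hne hlump K l s (t - s)
    rw [add_tsub_cancel_of_le hst] at h
    rw [dist_comm, Real.dist_eq, dist_comm, NNReal.dist_eq, mul_comm]
    refine h.trans (le_of_eq ?_)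
    rw [NNReal.coe_sub hst, abs_of_nonneg (sub_nonneg.2 (NNReal.coe_le_coe.2 hst))]
  exact hlip.continuous.comp continuous_real_toNNReal

/-- The forward equation for the lumped chain killed outside the blocks of `K`. -/
lemma hasDerivWithinAt_taboo_region (hX : IsMarkovChain X P Q) (hν : IsMarkovLaw X P ν)
    (hcons : IsConservative Q) (hne : IsNonexplosive X P) (hlump : IsLumpable Q E o)
    (K : Finset ι) (l : ι) (hl : l ∈ K) (hlo : l ≠ o) {t : ℝ} (ht : 0 ≤ t) :
    HasDerivWithinAt (fun s : ℝ => taboo X ν (region E o K) s.toNNReal (E.block l))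
      (∑ k ∈ K, taboo X ν (region E o K) t.toNNReal (E.block k) * lumpedMatrix Q E o k l)
      (Set.Ici t) t := by
  classical
  have := hν.isProbabilityMeasure
  set W := region E o K with hW
  set τ := t.toNNReal
  refine hasDerivWithinAt_Ici_of_shift (hasDerivWithinAt_Ici_zero_iff.2 ?_)
  -- the derivative, as a sum over the states
  have hsum : HasSum (fun j => taboo X ν W τ {j} *
      (if E.index j ∈ K then lumpedMatrix Q E o (E.index j) l else 0))
      (∑ k ∈ K, taboo X ν W τ (E.block k) * lumpedMatrix Q E o k l) := by
    have hs : Summable (fun j => taboo X ν W τ {j} *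
        (if E.index j ∈ K then lumpedMatrix Q E o (E.index j) l else 0)) := by
      have h2 := hasSum_taboo_ite hX hν W τ Set.univ
      simp only [Set.mem_univ, if_true, mul_one] at h2
      refine Summable.of_norm_bounded
        (h2.summable.mul_right (∑ k ∈ K, |lumpedMatrix Q E o k l|)) fun j => ?_
      rw [Real.norm_eq_abs, abs_mul, abs_of_nonneg (taboo_nonneg _ _ _ _)]
      refine mul_le_mul_of_nonneg_left ?_ (taboo_nonneg _ _ _ _)
      split_ifs with hj
      · exact Finset.single_le_sum (f := fun k => |lumpedMatrix Q E o k l|)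
          (fun k _ => abs_nonneg _) hj
      · rw [abs_zero]; exact Finset.sum_nonneg fun _ _ => abs_nonneg _
    have h3 := hasSum_taboo_fiber hX hν E.index W τ
      (φ := fun k => if k ∈ K then lumpedMatrix Q E o k l else 0) hs.hasSum
    have h4 : HasSum (fun k => taboo X ν W τ (E.index ⁻¹' {k}) *
          if k ∈ K then lumpedMatrix Q E o k l else 0)
        (∑ k ∈ K, taboo X ν W τ (E.index ⁻¹' {k}) *
          if k ∈ K then lumpedMatrix Q E o k l else 0) :=
      hasSum_sum_of_ne_finset_zero fun k hk => by simp [hk]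
    have h5 : (∑ k ∈ K, taboo X ν W τ (E.index ⁻¹' {k}) *
          if k ∈ K then lumpedMatrix Q E o k l else 0) =
        ∑ k ∈ K, taboo X ν W τ (E.block k) * lumpedMatrix Q E o k l :=
      Finset.sum_congr rfl fun k hk => by rw [if_pos hk, E.block_eq_preimage]
    rw [← h5, ← h3.unique h4]
    exact hs.hasSum
  rw [← hsum.tsum_eq]
  have hbound := hasSum_taboo_ite hX hν W τ Set.univ
  simp only [Set.mem_univ, if_true, mul_one] at hbound
  have hlim := tendsto_tsum_of_dominated_convergence (𝓕 := 𝓝[>] (0 : ℝ))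
    (f := fun h j => taboo X ν W τ {j} *
      (taboo X (P j) W h.toNNReal (E.block l) - if j ∈ E.block l then 1 else 0) / h)
    (g := fun j => taboo X ν W τ {j} *
      (if E.index j ∈ K then lumpedMatrix Q E o (E.index j) l else 0))
    (bound := fun j => taboo X ν W τ {j} * exitBound Q E o K)
    (hbound.summable.mul_right _) ?_ ?_
  · refine hlim.congr' ?_
    filter_upwards [self_mem_nhdsWithin] with h hh
    have h1 := (hasSum_taboo_sub hX hν W (E.block l) τ h.toNNReal).div_const h
    rw [h1.tsum_eq, Real.toNNReal_add ht (le_of_lt hh), add_zero]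
  · intro j
    by_cases hj : j ∈ W
    · have h1 := hasDerivWithinAt_Ici_zero_iff.1 (hasDerivWithinAt_taboo hX hcons hj (E.block l))
      rw [Set.inter_eq_left.2 (block_subset_region hl hlo)] at h1
      have hj' := mem_region.1 hj
      rw [rateTo_block hcons hlump hj'.1] at h1
      rw [if_pos hj'.2]
      refine (h1.const_mul _).congr fun h => ?_
      rw [Real.toNNReal_zero, taboo_zero hX hj, mul_div_assoc]
    · have h0 : taboo X ν W τ {j} = 0 :=
        taboo_eq_zero_of_disjoint (Set.disjoint_singleton_right.2 hj) ν τ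
      simp only [h0, zero_mul, zero_div]
      exact tendsto_const_nhds
  · filter_upwards [self_mem_nhdsWithin] with h hh j
    have hh' : (0 : ℝ) < h := hh
    have h1 := norm_taboo_mul_sub_le (ν := ν) hX hcons hne hlump K l τ h.toNNReal j
    rw [Real.coe_toNNReal _ hh'.le] at h1
    rw [Real.norm_eq_abs, abs_div, abs_of_pos hh', div_le_iff₀ hh']
    refine h1.trans (le_of_eq ?_)
    ring

end

/-! ### Lumpability of the killed chain -/

section

variable {S Ω ι : Type*} [MeasurableSpace Ω] {X : ℝ≥0 → Ω → S} {P : S → Measure Ω}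
  {Q : S → S → ℝ} {ν : Measure Ω} {E : BlockPartition S ι} {o : ι}

lemma taboo_region_eq_zero {K : Finset ι} {l : ι} (hl : ¬(l ∈ K ∧ l ≠ o)) (ν : Measure Ω)
    (t : ℝ≥0) : taboo X ν (region E o K) t (E.block l) = 0 := by
  refine taboo_eq_zero_of_disjoint (Set.disjoint_left.2 fun j hj hjl => hl ?_) ν t
  rw [mem_region, E.mem_block_iff.1 hjl] at hj
  exact ⟨hj.2, hj.1⟩

open Classical in
lemma taboo_rep_zero (hX : IsMarkovChain X P Q) {W : Set S} {k : ι} (hk : E.rep k ∈ W) (l : ι) :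
    taboo X (P (E.rep k)) W 0 (E.block l) = if k = l then 1 else 0 := by
  rw [taboo_zero hX hk]
  simp only [E.mem_block_iff, E.index_rep]

variable [Countable S]

/-- The block-valued chain killed outside finitely many blocks has the same law for all the initial
states in a block: the lumped forward equation is a finite linear system of differential equations,
and has only one solution. -/
lemma taboo_region_congr (hX : IsMarkovChain X P Q) (hcons : IsConservative Q)
    (hne : IsNonexplosive X P) (hlump : IsLumpable Q E o) (K : Finset ι) {i i' : S}
    (hii' : E.index i = E.index i') (t : ℝ≥0) (l : ι) :
    taboo X (P i) (region E o K) t (E.block l) = taboo X (P i') (region E o K) t (E.block l) := by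
  classical
  by_cases hl : l ∈ K ∧ l ≠ o
  swap
  · rw [taboo_region_eq_zero hl, taboo_region_eq_zero hl]
  by_cases hi : i ∈ region E o K
  swap
  · have hi' : i' ∉ region E o K := by rwa [mem_region, ← hii', ← mem_region]
    rw [taboo_of_notMem_start hX hi, taboo_of_notMem_start hX hi']
  have hi' : i' ∈ region E o K := by rwa [mem_region, ← hii', ← mem_region]
  let ι' := {k : ι // k ∈ K.erase o}
  let M : Matrix ι' ι' ℝ := fun k l => lumpedMatrix Q E o k l
  let L : (ι' → ℝ) →L[ℝ] (ι' → ℝ) := LinearMap.toContinuousLinearMap M.vecMulLinear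
  let F : S → ℝ → ι' → ℝ := fun i t l => taboo X (P i) (region E o K) t.toNNReal (E.block l)
  have hmem : ∀ l : ι', (l : ι) ∈ K ∧ (l : ι) ≠ o := fun l =>
    ⟨Finset.mem_of_mem_erase l.2, Finset.ne_of_mem_erase l.2⟩
  have hcont : ∀ i, Continuous (F i) := fun i => continuous_pi fun l =>
    continuous_taboo_region hX (hX.isMarkovLaw i) hcons hne hlump K l
  have hderiv : ∀ i, ∀ s ∈ Set.Ico (0 : ℝ) t, HasDerivWithinAt (F i) (L (F i s)) (Set.Ici s) s := by
    intro i s hs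
    rw [hasDerivWithinAt_pi]
    intro l
    have h := hasDerivWithinAt_taboo_region hX (hX.isMarkovLaw i) hcons hne hlump K l (hmem l).1
      (hmem l).2 hs.1
    convert! h using 1
    change (∑ k : ι', F i s k * M k l) = _
    rw [Finset.sum_coe_sort (K.erase o) fun k =>
      taboo X (P i) (region E o K) s.toNNReal (E.block k) * lumpedMatrix Q E o k l]
    refine Finset.sum_erase _ ?_
    rw [lumpedMatrix_self_row, mul_zero]
  have h0 : F i 0 = F i' 0 := by
    funext l
    simp only [F, Real.toNNReal_zero]
    rw [taboo_zero hX hi, taboo_zero hX hi']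
    simp only [E.mem_block_iff, hii']
  have huniq := ODE_solution_unique_of_mem_Icc_right (v := fun _ => L) (s := fun _ => Set.univ)
    (K := ‖L‖₊) (fun s _ => L.lipschitz.lipschitzOnWith) (hcont i).continuousOn (hderiv i)
    (fun _ _ => Set.mem_univ _) (hcont i').continuousOn (hderiv i') (fun _ _ => Set.mem_univ _) h0
  have h := congrFun (huniq ⟨t.coe_nonneg, le_rfl⟩) ⟨l, Finset.mem_erase.2 ⟨hl.2, hl.1⟩⟩
  simpa only [F, Real.toNNReal_coe] using h

lemma tendsto_taboo_region (hν : IsMarkovLaw X P ν) {t : ℝ≥0}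
    (hfin : ∀ᵐ ω ∂ν, ((fun u => X u ω) '' Set.Iic t).Finite) (E : BlockPartition S ι) (o : ι)
    (B : Set S) :
    Tendsto (fun K : Finset ι => taboo X ν (region E o K) t B) atTop
      (𝓝 (taboo X ν (E.block o)ᶜ t B)) := by
  have := E.countable_index
  have := hν.isProbabilityMeasure
  exact tendsto_taboo_finset hfin E.index _ B

/-- Lumpability of the chain killed in the block `o`. -/
lemma taboo_compl_congr (hX : IsMarkovChain X P Q) (hcons : IsConservative Q)
    (hne : IsNonexplosive X P) (hlump : IsLumpable Q E o) {i i' : S}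
    (hii' : E.index i = E.index i') (t : ℝ≥0) (l : ι) :
    taboo X (P i) (E.block o)ᶜ t (E.block l) = taboo X (P i') (E.block o)ᶜ t (E.block l) := by
  refine tendsto_nhds_unique
    (tendsto_taboo_region (hX.isMarkovLaw i) (ae_finite_range hX hne i t) E o _)
    ((tendsto_taboo_region (hX.isMarkovLaw i') (ae_finite_range hX hne i' t) E o _).congr
      fun K => ?_)
  exact (taboo_region_congr hX hcons hne hlump K hii' t l).symm

/-- The block probabilities add up to the probability of survival. -/
lemma hasSum_taboo_block (hX : IsMarkovChain X P Q) (hν : IsMarkovLaw X P ν)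
    (E : BlockPartition S ι) (W : Set S) (t : ℝ≥0) :
    HasSum (fun l => taboo X ν W t (E.block l)) (taboo X ν W t Set.univ) := by
  classical
  have h := hasSum_taboo_ite hX hν W t Set.univ
  simp only [Set.mem_univ, if_true] at h
  have h2 := hasSum_taboo_fiber hX hν E.index W t (φ := fun _ => 1) h
  simpa only [mul_one, ← E.block_eq_preimage] using h2

lemma taboo_compl_univ_congr (hX : IsMarkovChain X P Q) (hcons : IsConservative Q)
    (hne : IsNonexplosive X P) (hlump : IsLumpable Q E o) {i i' : S}
    (hii' : E.index i = E.index i') (t : ℝ≥0) :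
    taboo X (P i) (E.block o)ᶜ t Set.univ = taboo X (P i') (E.block o)ᶜ t Set.univ := by
  refine (hasSum_taboo_block hX (hX.isMarkovLaw i) E _ t).unique ?_
  convert! hasSum_taboo_block hX (hX.isMarkovLaw i') E (E.block o)ᶜ t using 1
  ext l
  exact taboo_compl_congr hX hcons hne hlump hii' t l

/-- The Chapman–Kolmogorov equation at the level of the blocks. -/
lemma hasSum_taboo_block_add (hX : IsMarkovChain X P Q) (hν : IsMarkovLaw X P ν)
    (E : BlockPartition S ι) {W B : Set S} {t : ℝ≥0}
    (hW : ∀ i i', E.index i = E.index i' → taboo X (P i) W t B = taboo X (P i') W t B) (s : ℝ≥0) :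
    HasSum (fun k => taboo X ν W s (E.block k) * taboo X (P (E.rep k)) W t B)
      (taboo X ν W (s + t) B) := by
  have h := hasSum_taboo_add hX hν W s t B
  have h1 : (fun j => taboo X ν W s {j} * taboo X (P j) W t B) =
      fun j => taboo X ν W s {j} * taboo X (P (E.rep (E.index j))) W t B := by
    ext j
    rw [hW j (E.rep (E.index j)) (E.index_rep _).symm]
  rw [h1] at h
  have h2 := hasSum_taboo_fiber hX hν E.index W s
    (φ := fun k => taboo X (P (E.rep k)) W t B) h
  simpa only [← E.block_eq_preimage] using h2

lemma taboo_region_add (hX : IsMarkovChain X P Q) (hν : IsMarkovLaw X P ν)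
    (hcons : IsConservative Q) (hne : IsNonexplosive X P) (hlump : IsLumpable Q E o) (K : Finset ι)
    (s t : ℝ≥0) (l : ι) :
    taboo X ν (region E o K) (s + t) (E.block l) =
      ∑ k ∈ K, taboo X ν (region E o K) s (E.block k) *
        taboo X (P (E.rep k)) (region E o K) t (E.block l) := by
  have h := hasSum_taboo_block_add hX hν E (W := region E o K) (B := E.block l) (t := t)
    (fun i i' h => taboo_region_congr hX hcons hne hlump K h t l) s
  refine h.unique (hasSum_sum_of_ne_finset_zero fun k hk => ?_)
  rw [taboo_region_eq_zero (fun h => hk h.1), zero_mul]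

/-- The lumped backward equation in finitely many blocks. -/
lemma hasDerivWithinAt_taboo_region_rep (hX : IsMarkovChain X P Q) (hcons : IsConservative Q)
    (hne : IsNonexplosive X P) (hlump : IsLumpable Q E o) (K : Finset ι) {k : ι} (hk : k ∈ K)
    (hko : k ≠ o) (l : ι) {t : ℝ} (ht : 0 ≤ t) :
    HasDerivWithinAt (fun s : ℝ => taboo X (P (E.rep k)) (region E o K) s.toNNReal (E.block l))
      (∑ n ∈ K, lumpedMatrix Q E o k n *
        taboo X (P (E.rep n)) (region E o K) t.toNNReal (E.block l)) (Set.Ici t) t := by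
  apply hasDerivWithinAt_Ici_of_shift
  have h : HasDerivWithinAt (fun h : ℝ => ∑ n ∈ K,
      taboo X (P (E.rep k)) (region E o K) h.toNNReal (E.block n) *
        taboo X (P (E.rep n)) (region E o K) t.toNNReal (E.block l))
      (∑ n ∈ K, lumpedMatrix Q E o k n *
        taboo X (P (E.rep n)) (region E o K) t.toNNReal (E.block l)) (Set.Ici 0) 0 := by
    refine HasDerivWithinAt.fun_sum fun n hn => ?_
    by_cases hno : n = o
    · have h0 : taboo X (P (E.rep n)) (region E o K) t.toNNReal (E.block l) = 0 := by
        refine taboo_of_notMem_start hX (fun hmem => ?_) _ _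
        rw [mem_region, E.index_rep] at hmem
        exact hmem.1 hno
      simp only [h0, mul_zero]
      exact hasDerivWithinAt_const _ _ _
    · have hmem : E.rep k ∈ region E o K := by
        rw [mem_region, E.index_rep]; exact ⟨hko, hk⟩
      have h1 := hasDerivWithinAt_taboo hX hcons hmem (E.block n)
      rw [Set.inter_eq_left.2 (block_subset_region hn hno),
        rateTo_block hcons hlump (by rwa [E.index_rep]), E.index_rep] at h1
      exact h1.mul_const _
  refine h.congr_of_mem (fun s hs => ?_) Set.self_mem_Ici
  rw [Real.toNNReal_add ht hs, add_comm,
    taboo_region_add hX (hX.isMarkovLaw _) hcons hne hlump K]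

/-- A row vector which is `α`-subinvariant for the lumped matrix is `α`-subinvariant for the
lumped semigroup: by the backward equation, `t ↦ e^{αt} (m Ḡ(t))_l` does not increase. -/
lemma sum_mul_taboo_region_le (hX : IsMarkovChain X P Q) (hcons : IsConservative Q)
    (hne : IsNonexplosive X P) (hlump : IsLumpable Q E o) (K : Finset ι) (m : ι → ℝ) (α : ℝ)
    (hm : ∀ l ∈ K, l ≠ o → ∑ k ∈ K, m k * lumpedMatrix Q E o k l ≤ -α * m l) {l : ι} (hl : l ∈ K)
    (hlo : l ≠ o) (t : ℝ≥0) :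
    ∑ k ∈ K, m k * taboo X (P (E.rep k)) (region E o K) t (E.block l) ≤
      Real.exp (-α * t) * m l := by
  classical
  set g : ι → ℝ → ℝ := fun k s => taboo X (P (E.rep k)) (region E o K) s.toNNReal (E.block l)
    with hg
  have hgo : ∀ s, g o s = 0 := fun s => by
    refine taboo_of_notMem_start hX (fun hmem => ?_) _ _
    rw [mem_region, E.index_rep] at hmem
    exact hmem.1 rfl
  have hgcont : ∀ k, Continuous (g k) := fun k =>
    continuous_taboo_region hX (hX.isMarkovLaw _) hcons hne hlump K l
  have hgderiv : ∀ k ∈ K, ∀ s : ℝ, 0 ≤ s → HasDerivWithinAt (g k)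
      (∑ n ∈ K, lumpedMatrix Q E o k n * g n s) (Set.Ici s) s := by
    intro k hk s hs
    by_cases hko : k = o
    · subst hko
      have h1 : g k = fun _ => 0 := funext hgo
      simp only [lumpedMatrix_self_row, zero_mul, Finset.sum_const_zero]
      rw [h1]
      exact hasDerivWithinAt_const _ _ _
    · exact hasDerivWithinAt_taboo_region_rep hX hcons hne hlump K hk hko l hs
  have hmain := image_le_of_deriv_right_le_deriv_boundary
    (f := fun s => Real.exp (α * s) * ∑ k ∈ K, m k * g k s)
    (f' := fun s => Real.exp (α * s) * α * (∑ k ∈ K, m k * g k s) +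
      Real.exp (α * s) * ∑ k ∈ K, m k * ∑ n ∈ K, lumpedMatrix Q E o k n * g n s)
    (a := 0) (b := t) (B := fun _ => m l) (B' := fun _ => 0) ?_ ?_ ?_ continuousOn_const
    (fun s _ => hasDerivWithinAt_const _ _ _) ?_ (Set.right_mem_Icc.2 t.coe_nonneg)
  · simp only [hg, Real.toNNReal_coe] at hmain
    rw [neg_mul, Real.exp_neg, ← div_eq_inv_mul, le_div_iff₀ (Real.exp_pos _), mul_comm]
    exact hmain
  · refine Continuous.continuousOn ?_
    refine Continuous.mul (by fun_prop) (continuous_finsetSum _ fun k _ => ?_)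
    exact (hgcont k).const_mul _
  · intro s hs
    have h1 : HasDerivWithinAt (fun s : ℝ => Real.exp (α * s)) (Real.exp (α * s) * α)
        (Set.Ici s) s := by
      have := ((hasDerivAt_id s).const_mul α).exp
      simpa using this.hasDerivWithinAt
    exact h1.mul (HasDerivWithinAt.fun_sum fun k hk => (hgderiv k hk s hs.1).const_mul (m k))
  · simp only [mul_zero, Real.exp_zero, one_mul]
    refine le_of_eq ?_
    rw [Finset.sum_eq_single_of_mem l hl]
    · simp only [hg, Real.toNNReal_zero]
      rw [taboo_rep_zero hX (by rw [mem_region, E.index_rep]; exact ⟨hlo, hl⟩), if_pos rfl, mul_one]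
    · intro k hk hkl
      by_cases hko : k = o
      · rw [hko, hgo, mul_zero]
      · simp only [hg, Real.toNNReal_zero]
        rw [taboo_rep_zero hX (by rw [mem_region, E.index_rep]; exact ⟨hko, hk⟩), if_neg hkl,
          mul_zero]
  · intro s _
    have h1 : ∑ k ∈ K, m k * ∑ n ∈ K, lumpedMatrix Q E o k n * g n s =
        ∑ n ∈ K, (∑ k ∈ K, m k * lumpedMatrix Q E o k n) * g n s := by
      simp only [Finset.mul_sum, Finset.sum_mul]
      rw [Finset.sum_comm]
      exact Finset.sum_congr rfl fun n _ => Finset.sum_congr rfl fun k _ => by ring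
    have h2 : ∑ n ∈ K, (∑ k ∈ K, m k * lumpedMatrix Q E o k n) * g n s ≤
        ∑ n ∈ K, (-α * m n) * g n s := by
      refine Finset.sum_le_sum fun n hn => ?_
      by_cases hno : n = o
      · rw [hno, hgo]; simp
      · exact mul_le_mul_of_nonneg_right (hm n hn hno) (taboo_nonneg _ _ _ _)
    have h3 : ∑ n ∈ K, (-α * m n) * g n s = -α * ∑ k ∈ K, m k * g k s := by
      rw [Finset.mul_sum]
      exact Finset.sum_congr rfl fun n _ => by ring
    rw [h1, mul_assoc, ← mul_add]
    exact mul_nonpos_of_nonneg_of_nonpos (Real.exp_nonneg _) (by linarith)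

end

/-! ### The initial law -/

section

variable {S Ω ι : Type*} [MeasurableSpace Ω] {X : ℝ≥0 → Ω → S} {P : S → Measure Ω}
  {Q : S → S → ℝ} {E : BlockPartition S ι} {o : ι} {μ : PMF S}

lemma lumpedLaw_nonneg (μ : PMF S) (E : BlockPartition S ι) (k : ι) : 0 ≤ lumpedLaw μ E k :=
  tsum_nonneg fun _ => ENNReal.toReal_nonneg

lemma lumpedLaw_self (hμ : μ.support ⊆ (E.block o)ᶜ) : lumpedLaw μ E o = 0 := by
  have h : ∀ i : E.block o, (μ i).toReal = 0 := by
    intro i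
    have : (i : S) ∉ μ.support := fun hi => hμ hi i.2
    rw [PMF.mem_support_iff, not_not] at this
    simp [this]
  simp [lumpedLaw, h]

lemma hasSum_absorption_rate (hμ : μ.support ⊆ (E.block o)ᶜ) {α : ℝ}
    (hα : LumpedEquation Q μ E o α) :
    HasSum (fun k => lumpedLaw μ E k * lumpedMatrix Q E o k o) α := by
  simpa [lumpedLaw_self hμ] using hα o

variable [Countable S]

lemma taboo_startFrom_zero (hX : IsMarkovChain X P Q) (μ : PMF S) {W B : Set S} (hB : B ⊆ W) :
    taboo X (startFrom P μ) W 0 B = ∑' i : B, (μ i).toReal := by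
  classical
  have h1 : stay X W 0 ∩ {ω | X 0 ω ∈ B} = {ω | X 0 ω ∈ B} := by
    refine Set.inter_eq_right.2 fun ω hω u hu => ?_
    obtain rfl : u = 0 := le_antisymm hu bot_le
    exact hB hω
  have h2 : ∀ i, P i {ω | X 0 ω ∈ B} = if i ∈ B then 1 else 0 := by
    intro i
    rw [← hX.measure_start_inter]
    split_ifs with hi
    · rw [← hX.start i]
      congr 1
      exact Set.inter_eq_left.2 fun ω hω => by
        have : X 0 ω = i := hω
        change X 0 ω ∈ B
        rwa [this]
    · rw [← measure_empty (μ := P i)]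
      congr 1
      ext ω
      simp only [Set.mem_inter_iff, Set.mem_ofPred_eq, Set.mem_empty_iff_false, iff_false]
      rintro ⟨rfl, h⟩
      exact hi h
  have h3 : (fun i => μ i * P i {ω | X 0 ω ∈ B}) = B.indicator μ := by
    ext i
    rw [h2]
    by_cases hi : i ∈ B <;> simp [hi]
  rw [taboo, h1, measureReal_def, startFrom_apply μ (hX.measurableSet_preimage 0 B), h3,
    ← tsum_subtype, ENNReal.tsum_toReal_eq fun i => μ.apply_ne_top _]

lemma hasSum_lumpedLaw (hX : IsMarkovChain X P Q) (μ : PMF S) (E : BlockPartition S ι) :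
    HasSum (lumpedLaw μ E) 1 := by
  have := (hX.isMarkovLaw_startFrom μ).isProbabilityMeasure
  have h := hasSum_taboo_block hX (hX.isMarkovLaw_startFrom μ) E Set.univ 0
  simp only [taboo_startFrom_zero hX μ (Set.subset_univ _)] at h
  have h1 : ∑' i : (Set.univ : Set S), (μ i).toReal = 1 := by
    rw [tsum_univ (fun i => (μ i).toReal), ← ENNReal.tsum_toReal_eq fun i => μ.apply_ne_top _,
      μ.tsum_coe, ENNReal.toReal_one]
  rwa [h1] at h

lemma taboo_startFrom_zero_block (hX : IsMarkovChain X P Q) (hμ : μ.support ⊆ (E.block o)ᶜ)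
    (k : ι) : taboo X (startFrom P μ) (E.block o)ᶜ 0 (E.block k) = lumpedLaw μ E k := by
  by_cases hk : k = o
  · rw [hk, lumpedLaw_self hμ]
    exact taboo_eq_zero_of_disjoint disjoint_compl_left _ _
  · exact taboo_startFrom_zero hX μ (Set.disjoint_left.1 (E.disjoint hk))

lemma taboo_startFrom_zero_univ (hX : IsMarkovChain X P Q) (hμ : μ.support ⊆ (E.block o)ᶜ) :
    taboo X (startFrom P μ) (E.block o)ᶜ 0 Set.univ = 1 := by
  refine (hasSum_taboo_block hX (hX.isMarkovLaw_startFrom μ) E _ 0).unique ?_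
  simp only [taboo_startFrom_zero_block hX hμ]
  exact hasSum_lumpedLaw hX μ E

lemma hasSum_lumpedLaw_mul_taboo (hX : IsMarkovChain X P Q) (hcons : IsConservative Q)
    (hne : IsNonexplosive X P) (hlump : IsLumpable Q E o) (hμ : μ.support ⊆ (E.block o)ᶜ)
    (t : ℝ≥0) (l : ι) :
    HasSum (fun k => lumpedLaw μ E k * taboo X (P (E.rep k)) (E.block o)ᶜ t (E.block l))
      (taboo X (startFrom P μ) (E.block o)ᶜ t (E.block l)) := by
  have h := hasSum_taboo_block_add hX (hX.isMarkovLaw_startFrom μ) E (W := (E.block o)ᶜ)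
    (B := E.block l) (t := t) (fun i i' h => taboo_compl_congr hX hcons hne hlump h t l) 0
  simpa only [taboo_startFrom_zero_block hX hμ, zero_add] using h

lemma taboo_startFrom_region (hX : IsMarkovChain X P Q) (hcons : IsConservative Q)
    (hne : IsNonexplosive X P) (hlump : IsLumpable Q E o) (hμ : μ.support ⊆ (E.block o)ᶜ)
    (K : Finset ι) (t : ℝ≥0) (l : ι) :
    taboo X (startFrom P μ) (region E o K) t (E.block l) =
      ∑ k ∈ K, lumpedLaw μ E k * taboo X (P (E.rep k)) (region E o K) t (E.block l) := by
  have h := taboo_region_add hX (hX.isMarkovLaw_startFrom μ) hcons hne hlump K 0 t l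
  rw [zero_add] at h
  rw [h]
  refine Finset.sum_congr rfl fun k hk => ?_
  by_cases hko : k = o
  · rw [hko, lumpedLaw_self hμ, taboo_region_eq_zero (fun h => h.2 rfl)]
  · rw [taboo_startFrom_zero hX μ (block_subset_region hk hko)]
    rfl

lemma ae_start_startFrom (hX : IsMarkovChain X P Q) (hμ : μ.support ⊆ (E.block o)ᶜ) :
    ∀ᵐ ω ∂(startFrom P μ), X 0 ω ∈ (E.block o)ᶜ := by
  refine ae_startFrom_of_forall μ fun i hi => ?_
  have := hX.isProbabilityMeasure i
  have h : ∀ᵐ ω ∂(P i), X 0 ω = i :=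
    (prob_compl_eq_zero_iff (hX.measurable 0 i)).2 (hX.start i)
  filter_upwards [h] with ω hω
  rw [hω]; exact hμ hi

lemma ae_finite_range_startFrom (hX : IsMarkovChain X P Q) (hne : IsNonexplosive X P) (μ : PMF S)
    (t : ℝ≥0) : ∀ᵐ ω ∂(startFrom P μ), ((fun u => X u ω) '' Set.Iic t).Finite :=
  ae_startFrom_of_forall μ fun i _ => ae_finite_range hX hne i t

/-- Decrease of the survival probability, from the Markov property: the probability of absorption
in a further time `h` depends only on the current block. -/
lemma hasSum_taboo_mul_exit (hX : IsMarkovChain X P Q) (hcons : IsConservative Q)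
    (hne : IsNonexplosive X P) (hlump : IsLumpable Q E o) {ν : Measure Ω}
    (hν : IsMarkovLaw X P ν) (t h : ℝ≥0) :
    HasSum (fun k => taboo X ν (E.block o)ᶜ t (E.block k) *
        (1 - taboo X (P (E.rep k)) (E.block o)ᶜ h Set.univ))
      (taboo X ν (E.block o)ᶜ t Set.univ - taboo X ν (E.block o)ᶜ (t + h) Set.univ) := by
  have h1 := hasSum_taboo_block_add hX hν E (W := (E.block o)ᶜ)
    (B := Set.univ) (t := h) (fun i i' h' => taboo_compl_univ_congr hX hcons hne hlump h' h) t
  have h2 := hasSum_taboo_block hX hν E (E.block o)ᶜ t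
  convert! h2.sub h1 using 1
  ext k; ring

lemma hasSum_lumpedLaw_mul_exit (hX : IsMarkovChain X P Q) (hcons : IsConservative Q)
    (hne : IsNonexplosive X P) (hlump : IsLumpable Q E o) (hμ : μ.support ⊆ (E.block o)ᶜ)
    (h : ℝ≥0) :
    HasSum (fun k => lumpedLaw μ E k * (1 - taboo X (P (E.rep k)) (E.block o)ᶜ h Set.univ))
      (1 - taboo X (startFrom P μ) (E.block o)ᶜ h Set.univ) := by
  have h1 := hasSum_taboo_mul_exit hX hcons hne hlump (hX.isMarkovLaw_startFrom μ) 0 h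
  simpa only [taboo_startFrom_zero_block hX hμ, zero_add, taboo_startFrom_zero_univ hX hμ] using h1

lemma hasDerivWithinAt_exit_rep (hX : IsMarkovChain X P Q) (hcons : IsConservative Q)
    (hlump : IsLumpable Q E o) {k : ι} (hk : k ≠ o) :
    HasDerivWithinAt (fun h : ℝ => 1 - taboo X (P (E.rep k)) (E.block o)ᶜ h.toNNReal Set.univ)
      (lumpedMatrix Q E o k o) (Set.Ici 0) 0 := by
  have hmem : E.rep k ∈ (E.block o)ᶜ := by
    rw [Set.mem_compl_iff, E.mem_block_iff, E.index_rep]; exact hk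
  have h := hasDerivWithinAt_exit hX hcons hmem
  rwa [compl_compl, rateTo_block hcons hlump (by rwa [E.index_rep]), E.index_rep] at h

/-- A linear bound for the probability of absorption. -/
lemma one_sub_survival_le (hX : IsMarkovChain X P Q) (hcons : IsConservative Q)
    (hne : IsNonexplosive X P) (hlump : IsLumpable Q E o) (hμ : μ.support ⊆ (E.block o)ᶜ) {c : ℝ}
    (hc : ∀ K : Finset ι, ∑ k ∈ K, lumpedLaw μ E k * lumpedMatrix Q E o k o ≤ c)
    (hle : ∀ s k, taboo X (startFrom P μ) (E.block o)ᶜ s (E.block k) ≤ lumpedLaw μ E k)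
    (t : ℝ≥0) : 1 - taboo X (startFrom P μ) (E.block o)ᶜ t Set.univ ≤ t * c := by
  have := E.countable_index
  refine exit_le hX (hX.isMarkovLaw_startFrom μ) (ae_start_startFrom hX hμ)
    (ae_finite_range_startFrom hX hne μ t) E.index
    (fun k δ => 1 - taboo X (P (E.rep k)) (E.block o)ᶜ δ Set.univ)
    (fun k => lumpedMatrix Q E o k o) (fun j _ δ => ?_) ?_ ?_
  · rw [taboo_compl_univ_congr hX hcons hne hlump (E.index_rep (E.index j)).symm δ]
  · rintro k ⟨j, hj, rfl⟩
    have hjo : E.index j ≠ o := by rwa [Set.mem_compl_iff, E.mem_block_iff] at hj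
    have h := tendsto_natCast_mul_sub (hasDerivWithinAt_exit_rep hX hcons hlump hjo) t.coe_nonneg
    refine h.congr fun n => ?_
    have hmem : E.rep (E.index j) ∈ (E.block o)ᶜ := by
      rw [Set.mem_compl_iff, E.mem_block_iff, E.index_rep]; exact hjo
    rw [toNNReal_div_natCast, Real.toNNReal_zero, taboo_zero hX hmem]
    simp
  · intro s _ K hK
    refine le_trans (Finset.sum_le_sum fun k hk => ?_) (hc K)
    rw [← E.block_eq_preimage]
    refine mul_le_mul_of_nonneg_right (hle s k) ?_
    obtain ⟨j, hj, rfl⟩ := hK hk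
    rw [Set.mem_compl_iff, E.mem_block_iff] at hj
    exact lumpedMatrix_nonneg hX (Ne.symm hj)

/-! ### From the lumped equation to the exponential law -/

/-- The lumped equation bounds the lumped killed law by `e^{-αt} μ̄`. -/
lemma taboo_le_exp_mul (hX : IsMarkovChain X P Q) (hcons : IsConservative Q)
    (hne : IsNonexplosive X P) (hlump : IsLumpable Q E o) (hμ : μ.support ⊆ (E.block o)ᶜ) {α : ℝ}
    (hα : LumpedEquation Q μ E o α) (t : ℝ≥0) (l : ι) :
    taboo X (startFrom P μ) (E.block o)ᶜ t (E.block l) ≤ Real.exp (-α * t) * lumpedLaw μ E l := by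
  classical
  by_cases hlo : l = o
  · rw [hlo, taboo_eq_zero_of_disjoint disjoint_compl_left]
    exact mul_nonneg (Real.exp_nonneg _) (lumpedLaw_nonneg _ _ _)
  have hlim := tendsto_taboo_region (hX.isMarkovLaw_startFrom μ)
    (ae_finite_range_startFrom hX hne μ t) E o (E.block l)
  refine le_of_tendsto hlim ?_
  filter_upwards [eventually_ge_atTop {l}] with K hK
  rw [taboo_startFrom_region hX hcons hne hlump hμ]
  refine sum_mul_taboo_region_le hX hcons hne hlump K _ α (fun n hn hno => ?_)
    (hK (Finset.mem_singleton_self l)) hlo t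
  have h := hα n
  rw [Set.indicator_of_notMem (by simpa using hno), mul_zero, add_zero] at h
  refine sum_le_hasSum K (fun k hk => ?_) h
  exact mul_nonneg (lumpedLaw_nonneg _ _ _)
    (lumpedMatrix_nonneg hX fun hnk => hk (hnk ▸ hn))

/-- Under the lumped equation, the time of absorption is exponential and the lumped law of the
surviving chain is constant. -/
lemma survival_eq_exp (hX : IsMarkovChain X P Q) (hcons : IsConservative Q)
    (hne : IsNonexplosive X P) (hlump : IsLumpable Q E o) (hμ : μ.support ⊆ (E.block o)ᶜ) {α : ℝ}
    (hα0 : 0 < α) (hα : LumpedEquation Q μ E o α) (t : ℝ≥0) :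
    taboo X (startFrom P μ) (E.block o)ᶜ t Set.univ = Real.exp (-α * t) := by
  set a : ℝ≥0 → ℝ := fun t => taboo X (startFrom P μ) (E.block o)ᶜ t Set.univ with ha
  have hν := hX.isMarkovLaw_startFrom μ
  have := hν.isProbabilityMeasure
  have hle := taboo_le_exp_mul hX hcons hne hlump hμ hα
  have hsum := hasSum_lumpedLaw hX μ E
  apply le_antisymm
  · have := hasSum_le (hle t) (hasSum_taboo_block hX hν E _ t) (hsum.mul_left _)
    simpa using this
  have hexp_le : ∀ s : ℝ≥0, Real.exp (-α * s) ≤ 1 := fun s => by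
    rw [Real.exp_le_one_iff]
    exact mul_nonpos_of_nonpos_of_nonneg (by linarith) s.coe_nonneg
  have habs : ∀ h : ℝ≥0, 1 - a h ≤ h * α := by
    refine one_sub_survival_le hX hcons hne hlump hμ (fun K => ?_) fun s k => ?_
    · refine sum_le_hasSum K (fun k _ => ?_) (hasSum_absorption_rate hμ hα)
      by_cases hko : k = o
      · rw [hko, lumpedMatrix_self_row, mul_zero]
      · exact mul_nonneg (lumpedLaw_nonneg _ _ _) (lumpedMatrix_nonneg hX (Ne.symm hko))
    · exact (hle s k).trans (mul_le_of_le_one_left (lumpedLaw_nonneg _ _ _) (hexp_le s))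
  -- the loss of mass during `h` is at most `e^{-αs}` times the loss for the initial law `μ`
  have hstep : ∀ s h : ℝ≥0, a s - Real.exp (-α * s) * (h * α) ≤ a (s + h) := by
    intro s h
    have h1 := hasSum_taboo_mul_exit hX hcons hne hlump hν (E := E) (o := o) s h
    have h2 := (hasSum_lumpedLaw_mul_exit hX hcons hne hlump hμ h).mul_left (Real.exp (-α * s))
    have h3 := hasSum_le (fun k => ?_) h1 h2
    · have h4 := mul_le_mul_of_nonneg_left (habs h) (Real.exp_nonneg (-α * s))
      simp only [ha] at h4 ⊢
      linarith
    · have := hX.isProbabilityMeasure (E.rep k)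
      rw [← mul_assoc]
      exact mul_le_mul_of_nonneg_right (hle s k) (sub_nonneg.2 (taboo_le_one _ _ _ _))
  have hiter : ∀ (δ : ℝ≥0), α * δ ≤ 1 → ∀ n : ℕ,
      Real.exp (-α * (n * δ)) - n * (α * δ) ^ 2 ≤ a (n * δ) := by
    intro δ hδ n
    have hδ0 : 0 ≤ α * δ := mul_nonneg hα0.le δ.coe_nonneg
    induction n with
    | zero => simp [ha, taboo_startFrom_zero_univ hX hμ]
    | succ n ih =>
      have h1 := hstep (n * δ) δ
      have h2 : ((n + 1 : ℕ) : ℝ≥0) * δ = n * δ + δ := by push_cast; ring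
      rw [h2]
      refine le_trans ?_ h1
      have h3 := Real.abs_exp_sub_one_sub_id_le (x := -(α * δ)) (by rwa [abs_neg, abs_of_nonneg hδ0])
      have h4 := (abs_le.1 h3).2
      have h5 : Real.exp (-α * (((n + 1 : ℕ) : ℝ) * δ)) =
          Real.exp (-α * (n * δ)) * Real.exp (-(α * δ)) := by
        rw [← Real.exp_add]; congr 1; push_cast; ring
      have h6 : Real.exp (-α * (n * δ)) ≤ 1 := by
        have := hexp_le (n * δ); push_cast at this; exact this
      have h7 := Real.exp_nonneg (-α * (n * δ))
      have h8 := mul_le_mul_of_nonneg_left h4 h7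
      have h9 := mul_le_mul_of_nonneg_right h6 (sq_nonneg (α * δ))
      rw [h5]
      push_cast
      rw [neg_sq] at h8
      linarith
  have hlim : Tendsto (fun n : ℕ => Real.exp (-α * t) - (α * t) ^ 2 / n) atTop
      (𝓝 (Real.exp (-α * t) - 0)) :=
    (tendsto_const_div_atTop_nhds_zero_nat _).const_sub _
  rw [sub_zero] at hlim
  refine le_of_tendsto hlim ?_
  obtain ⟨N, hN⟩ := exists_nat_ge (α * t)
  filter_upwards [eventually_ge_atTop N, eventually_gt_atTop 0] with n hn hn0
  have hn' : (0 : ℝ) < n := by exact_mod_cast hn0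
  have h := hiter (t / n) (by
    push_cast
    rw [← mul_div_assoc, div_le_one hn']
    exact hN.trans (by exact_mod_cast hn)) n
  rw [mul_div_cancel₀ _ (by exact_mod_cast hn0.ne')] at h
  refine le_trans (le_of_eq ?_) h
  push_cast
  have h1 : (n : ℝ) * (t / n) = t := by field_simp
  rw [h1]
  congr 1
  field_simp

lemma taboo_eq_exp_mul (hX : IsMarkovChain X P Q) (hcons : IsConservative Q)
    (hne : IsNonexplosive X P) (hlump : IsLumpable Q E o) (hμ : μ.support ⊆ (E.block o)ᶜ) {α : ℝ}
    (hα0 : 0 < α) (hα : LumpedEquation Q μ E o α) (t : ℝ≥0) (l : ι) :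
    taboo X (startFrom P μ) (E.block o)ᶜ t (E.block l) = Real.exp (-α * t) * lumpedLaw μ E l := by
  have h1 := hasSum_taboo_block hX (hX.isMarkovLaw_startFrom μ) E (E.block o)ᶜ t
  have h2 := (hasSum_lumpedLaw hX μ E).mul_left (Real.exp (-α * t))
  have h3 := h2.sub h1
  rw [survival_eq_exp hX hcons hne hlump hμ hα0 hα, mul_one, sub_self,
    hasSum_zero_iff_of_nonneg
      (fun l => sub_nonneg.2 (taboo_le_exp_mul hX hcons hne hlump hμ hα t l))] at h3
  have := congrFun h3 l
  simp only [Pi.zero_apply] at this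
  linarith

end

/-! ### From the constant occupation law to the lumped equation -/

/-- A positive, nonincreasing solution of Cauchy's multiplicative equation is an exponential. -/
lemma exists_eq_exp_of_antitone {φ : ℝ≥0 → ℝ} (hpos : ∀ t, 0 < φ t) (hanti : Antitone φ)
    (hmul : ∀ s t, φ (s + t) = φ s * φ t) : ∃ α : ℝ, ∀ t : ℝ≥0, φ t = Real.exp (-α * t) := by
  set ψ : ℝ≥0 → ℝ := fun t => -Real.log (φ t) with hψ
  have hmono : Monotone ψ := fun s t h => neg_le_neg (Real.log_le_log (hpos t) (hanti h))
  have hadd : ∀ s t, ψ (s + t) = ψ s + ψ t := fun s t => by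
    simp only [hψ, hmul, Real.log_mul (hpos s).ne' (hpos t).ne']; ring
  have h0 : ψ 0 = 0 := by have := hadd 0 0; simp only [add_zero] at this; linarith
  have hnat : ∀ (n : ℕ) (t : ℝ≥0), ψ (n * t) = n * ψ t := by
    intro n t
    induction n with
    | zero => simp [h0]
    | succ n ih =>
      rw [show ((n + 1 : ℕ) : ℝ≥0) * t = n * t + t by push_cast; ring, hadd, ih]
      push_cast; ring
  have h1 : ∀ n : ℕ, ψ n = n * ψ 1 := fun n => by simpa using hnat n 1
  refine ⟨ψ 1, fun t => ?_⟩
  have hkey : ∀ n : ℕ, n * |ψ t - t * ψ 1| ≤ ψ 1 := by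
    intro n
    have hψ1 : 0 ≤ ψ 1 := h0 ▸ hmono zero_le_one
    have hlow := hmono (Nat.floor_le (zero_le : 0 ≤ (n : ℝ≥0) * t))
    have hup := hmono (Nat.lt_floor_add_one ((n : ℝ≥0) * t)).le
    rw [hadd, h1, hnat] at hup
    rw [h1, hnat] at hlow
    have hfl : ((⌊(n : ℝ≥0) * t⌋₊ : ℕ) : ℝ) ≤ n * t := by
      exact_mod_cast Nat.floor_le (zero_le : 0 ≤ (n : ℝ≥0) * t)
    have hfl' : (n : ℝ) * t ≤ (⌊(n : ℝ≥0) * t⌋₊ : ℕ) + 1 := by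
      exact_mod_cast (Nat.lt_floor_add_one ((n : ℝ≥0) * t)).le
    have e1 := mul_le_mul_of_nonneg_right hfl hψ1
    have e2 := mul_le_mul_of_nonneg_right hfl' hψ1
    rw [← abs_of_nonneg (Nat.cast_nonneg (α := ℝ) n), ← abs_mul, abs_le]
    constructor <;> linarith
  have hzero : ψ t - t * ψ 1 = 0 := by
    by_contra hne
    obtain ⟨n, hn⟩ := exists_nat_gt (ψ 1 / |ψ t - t * ψ 1|)
    rw [div_lt_iff₀ (abs_pos.2 hne)] at hn
    exact absurd (hkey n) (not_le.2 hn)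
  have h2 : Real.log (φ t) = -ψ 1 * t := by simp only [hψ] at hzero ⊢; linarith
  rw [← h2, Real.exp_log (hpos t)]

lemma hasDerivWithinAt_exp_mul (α c : ℝ) :
    HasDerivWithinAt (fun h : ℝ => Real.exp (α * h) * c) (α * c) (Set.Ici 0) 0 := by
  have := (((hasDerivAt_id (0 : ℝ)).const_mul α).exp.mul_const c).hasDerivWithinAt (s := Set.Ici 0)
  simpa using this

/-- Comparison of one-sided derivatives at `0`. -/
lemma le_of_hasDerivWithinAt_of_le {f g : ℝ → ℝ} {f' g' : ℝ}
    (hf : HasDerivWithinAt f f' (Set.Ici 0) 0) (hg : HasDerivWithinAt g g' (Set.Ici 0) 0)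
    (h0 : f 0 = g 0) (hfg : ∀ t, 0 ≤ t → f t ≤ g t) : f' ≤ g' := by
  rw [hasDerivWithinAt_Ici_zero_iff] at hf hg
  refine le_of_tendsto_of_tendsto hf hg ?_
  filter_upwards [self_mem_nhdsWithin] with h hh
  have hh' : (0 : ℝ) < h := hh
  rw [h0]
  have := hfg h hh'.le
  gcongr

section

variable {S Ω ι : Type*} [MeasurableSpace Ω] {X : ℝ≥0 → Ω → S} {P : S → Measure Ω}
  {Q : S → S → ℝ} {E : BlockPartition S ι} {o : ι} {μ : PMF S}

lemma survival_real_eq (hX : IsMarkovChain X P Q) (ν : Measure Ω) (D : Set S) (t : ℝ≥0) :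
    ν.real (survival X D t) = taboo X ν Dᶜ t Set.univ := by
  rw [survival_eq_stay hX.rightContinuous]; simp [taboo]

variable [Countable S]

lemma sum_absorption_rate_le (hX : IsMarkovChain X P Q) (hcons : IsConservative Q)
    (hne : IsNonexplosive X P) (hlump : IsLumpable Q E o) (hμ : μ.support ⊆ (E.block o)ᶜ) {α : ℝ}
    (ha : ∀ t : ℝ≥0, taboo X (startFrom P μ) (E.block o)ᶜ t Set.univ = Real.exp (-α * t))
    (K : Finset ι) : ∑ k ∈ K, lumpedLaw μ E k * lumpedMatrix Q E o k o ≤ α := by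
  have hg := (hasDerivWithinAt_exp_mul (-α) 1).const_sub 1
  have hf : HasDerivWithinAt (fun h : ℝ => ∑ k ∈ K, lumpedLaw μ E k *
      (1 - taboo X (P (E.rep k)) (E.block o)ᶜ h.toNNReal Set.univ))
      (∑ k ∈ K, lumpedLaw μ E k * lumpedMatrix Q E o k o) (Set.Ici 0) 0 := by
    refine HasDerivWithinAt.fun_sum fun k _ => ?_
    by_cases hko : k = o
    · simp only [hko, lumpedLaw_self hμ, zero_mul]
      exact hasDerivWithinAt_const _ _ _
    · exact (hasDerivWithinAt_exit_rep hX hcons hlump hko).const_mul _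
  have h := le_of_hasDerivWithinAt_of_le hf hg ?_ ?_
  · simpa using h
  · simp only [mul_zero, Real.exp_zero, Real.toNNReal_zero, mul_one, sub_self]
    refine Finset.sum_eq_zero fun k _ => ?_
    by_cases hko : k = o
    · rw [hko, lumpedLaw_self hμ, zero_mul]
    · rw [taboo_zero hX (by rw [Set.mem_compl_iff, E.mem_block_iff, E.index_rep]; exact hko)]
      simp
  · intro t ht
    have h1 := hasSum_lumpedLaw_mul_exit hX hcons hne hlump hμ t.toNNReal
    rw [ha, Real.coe_toNNReal _ ht] at h1
    rw [mul_one]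
    refine sum_le_hasSum K (fun k _ => mul_nonneg (lumpedLaw_nonneg _ _ _) ?_) h1
    have := hX.isProbabilityMeasure (E.rep k)
    exact sub_nonneg.2 (taboo_le_one _ _ _ _)

/-- The absorption rate under `μ̄` is the exponent `α`: it is at most `α` by Fatou's lemma, and at
least `α` by the first-passage bound, which needs nonexplosion. -/
lemma hasSum_absorption_rate_of_constant (hX : IsMarkovChain X P Q) (hcons : IsConservative Q)
    (hne : IsNonexplosive X P) (hlump : IsLumpable Q E o) (hμ : μ.support ⊆ (E.block o)ᶜ) {α : ℝ}
    (ha : ∀ t : ℝ≥0, taboo X (startFrom P μ) (E.block o)ᶜ t Set.univ = Real.exp (-α * t))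
    (hle : ∀ s k, taboo X (startFrom P μ) (E.block o)ᶜ s (E.block k) ≤ lumpedLaw μ E k) :
    HasSum (fun k => lumpedLaw μ E k * lumpedMatrix Q E o k o) α := by
  have hnn : ∀ k, 0 ≤ lumpedLaw μ E k * lumpedMatrix Q E o k o := fun k => by
    by_cases hko : k = o
    · rw [hko, lumpedMatrix_self_row, mul_zero]
    · exact mul_nonneg (lumpedLaw_nonneg _ _ _) (lumpedMatrix_nonneg hX (Ne.symm hko))
  have hK := sum_absorption_rate_le hX hcons hne hlump hμ ha
  have hs : Summable fun k => lumpedLaw μ E k * lumpedMatrix Q E o k o :=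
    summable_of_sum_le hnn hK
  have hge : α ≤ ∑' k, lumpedLaw μ E k * lumpedMatrix Q E o k o := by
    set c := ∑' k, lumpedLaw μ E k * lumpedMatrix Q E o k o
    have hf := (hasDerivWithinAt_exp_mul (-α) 1).const_sub 1
    have hg := ((hasDerivAt_id (0 : ℝ)).mul_const c).hasDerivWithinAt (s := Set.Ici 0)
    have h := le_of_hasDerivWithinAt_of_le hf hg (by simp) fun t ht => ?_
    · simpa using h
    · have h1 := one_sub_survival_le hX hcons hne hlump hμ
        (fun K => hs.sum_le_tsum K fun k _ => hnn k) hle t.toNNReal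
      rw [ha, Real.coe_toNNReal _ ht] at h1
      simpa using h1
  exact (le_antisymm (hs.tsum_le_of_sum_le hK) hge) ▸ hs.hasSum

/-- One half of the lumped equation, from the derivative at `0` and Fatou's lemma. -/
lemma sum_lumpedMatrix_le (hX : IsMarkovChain X P Q) (hcons : IsConservative Q)
    (hne : IsNonexplosive X P) (hlump : IsLumpable Q E o) (hμ : μ.support ⊆ (E.block o)ᶜ) {α : ℝ}
    {l : ι} (hlo : l ≠ o)
    (hf : ∀ t : ℝ≥0, taboo X (startFrom P μ) (E.block o)ᶜ t (E.block l) =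
      Real.exp (-α * t) * lumpedLaw μ E l)
    {K : Finset ι} (hl : l ∈ K) :
    ∑ k ∈ K, lumpedLaw μ E k * lumpedMatrix Q E o k l ≤ -α * lumpedLaw μ E l := by
  classical
  have hg := hasDerivWithinAt_exp_mul (-α) (lumpedLaw μ E l)
  have hmem : ∀ k ≠ o, E.rep k ∈ (E.block o)ᶜ := fun k hko => by
    rw [Set.mem_compl_iff, E.mem_block_iff, E.index_rep]; exact hko
  have hf' : HasDerivWithinAt (fun h : ℝ => ∑ k ∈ K, lumpedLaw μ E k *
      taboo X (P (E.rep k)) (E.block o)ᶜ h.toNNReal (E.block l))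
      (∑ k ∈ K, lumpedLaw μ E k * lumpedMatrix Q E o k l) (Set.Ici 0) 0 := by
    refine HasDerivWithinAt.fun_sum fun k _ => ?_
    by_cases hko : k = o
    · simp only [hko, lumpedLaw_self hμ, zero_mul]
      exact hasDerivWithinAt_const _ _ _
    · have h := hasDerivWithinAt_taboo hX hcons (hmem k hko) (E.block l)
      rw [Set.inter_eq_left.2 (show E.block l ⊆ (E.block o)ᶜ from
        Set.disjoint_left.1 (E.disjoint hlo)), rateTo_block hcons hlump (by rwa [E.index_rep]),
        E.index_rep] at h
      exact h.const_mul _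
  refine le_of_hasDerivWithinAt_of_le hf' hg ?_ ?_
  · simp only [mul_zero, Real.exp_zero, Real.toNNReal_zero, one_mul]
    rw [Finset.sum_eq_single_of_mem l hl, taboo_rep_zero hX (hmem l hlo), if_pos rfl, mul_one]
    intro k _ hkl
    by_cases hko : k = o
    · rw [hko, lumpedLaw_self hμ, zero_mul]
    · rw [taboo_rep_zero hX (hmem k hko), if_neg hkl, mul_zero]
  · intro t ht
    have h1 := hasSum_lumpedLaw_mul_taboo hX hcons hne hlump hμ t.toNNReal l
    rw [hf, Real.coe_toNNReal _ ht] at h1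
    exact sum_le_hasSum K (fun k _ => mul_nonneg (lumpedLaw_nonneg _ _ _) (taboo_nonneg _ _ _ _)) h1

/-- The other half of the lumped equation, from the forward equation: the flow into the block `l`
at any time is at most the flow `c` under `μ̄`. -/
lemma exp_mul_le_of_flow_le (hX : IsMarkovChain X P Q) (hcons : IsConservative Q)
    (hne : IsNonexplosive X P) (hlump : IsLumpable Q E o) {l : ι} (hlo : l ≠ o) {c : ℝ}
    (hle : ∀ s k, taboo X (startFrom P μ) (E.block o)ᶜ s (E.block k) ≤ lumpedLaw μ E k)
    (hc : ∀ K : Finset ι, l ∉ K → ∑ k ∈ K, lumpedLaw μ E k * lumpedMatrix Q E o k l ≤ c)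
    (T : ℝ≥0) :
    Real.exp (-lumpedMatrix Q E o l l * T) * taboo X (startFrom P μ) (E.block o)ᶜ T (E.block l) ≤
      lumpedLaw μ E l + T * (Real.exp (-lumpedMatrix Q E o l l * T) * c) := by
  classical
  set q := -lumpedMatrix Q E o l l with hq
  have hν := hX.isMarkovLaw_startFrom μ
  have hνp := hν.isProbabilityMeasure
  have hc0 : 0 ≤ c := by simpa using hc ∅ (by simp)
  have hq0 : 0 ≤ q := by
    have h := hasSum_lumpedMatrix hcons hlump (E := E) (o := o) l
    have := hasSum_le (f := fun m => if m = l then lumpedMatrix Q E o l l else 0)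
      (fun m => by
        split_ifs with hm
        · rw [hm]
        · exact lumpedMatrix_nonneg hX hm) (hasSum_ite_eq l _) h
    linarith
  have hlim := tendsto_taboo_region hν (ae_finite_range_startFrom hX hne μ T) E o (E.block l)
  refine le_of_tendsto (hlim.const_mul _) ?_
  filter_upwards [eventually_ge_atTop {l}] with K hK
  have hlK : l ∈ K := hK (Finset.mem_singleton_self l)
  set F : ι → ℝ → ℝ := fun k s => taboo X (startFrom P μ) (region E o K) s.toNNReal (E.block k)
    with hF
  have hFle : ∀ k s, F k s ≤ lumpedLaw μ E k := fun k s =>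
    (taboo_mono Set.inter_subset_left le_rfl _).trans (hle _ k)
  have hmain := image_le_of_deriv_right_le_deriv_boundary
    (f := fun s => Real.exp (q * s) * F l s)
    (f' := fun s => Real.exp (q * s) * q * F l s +
      Real.exp (q * s) * ∑ k ∈ K, F k s * lumpedMatrix Q E o k l)
    -- a linear majorant is enough, since only the limit `T → 0` of this bound is of interest
    (a := 0) (b := T) (B := fun s => lumpedLaw μ E l + s * (Real.exp (q * T) * c))
    (B' := fun _ => Real.exp (q * T) * c) ?_ ?_ ?_ (by fun_prop) ?_ ?_
    (Set.right_mem_Icc.2 T.coe_nonneg)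
  · simpa only [hF, Real.toNNReal_coe] using hmain
  · exact (Continuous.mul (by fun_prop)
      (continuous_taboo_region hX hν hcons hne hlump K l)).continuousOn
  · intro s hs
    have h1 : HasDerivWithinAt (fun s : ℝ => Real.exp (q * s)) (Real.exp (q * s) * q)
        (Set.Ici s) s := by
      have := ((hasDerivAt_id s).const_mul q).exp
      simpa using this.hasDerivWithinAt
    exact h1.mul (hasDerivWithinAt_taboo_region hX hν hcons hne hlump K l hlK hlo hs.1)
  · simpa using hFle l 0
  · intro s _
    have := ((hasDerivAt_id s).mul_const (Real.exp (q * T) * c)).const_add (lumpedLaw μ E l)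
    simpa using this.hasDerivWithinAt
  · intro s hs
    rw [← Finset.add_sum_erase K _ hlK]
    have h1 : ∑ k ∈ K.erase l, F k s * lumpedMatrix Q E o k l ≤ c := by
      refine le_trans (Finset.sum_le_sum fun k hk => ?_) (hc (K.erase l) (by simp))
      exact mul_le_mul_of_nonneg_right (hFle k s)
        (lumpedMatrix_nonneg hX (Finset.ne_of_mem_erase hk).symm)
    have h2 : Real.exp (q * s) ≤ Real.exp (q * T) :=
      Real.exp_le_exp.2 (mul_le_mul_of_nonneg_left hs.2.le hq0)
    calc Real.exp (q * s) * q * F l s + Real.exp (q * s) * (F l s * lumpedMatrix Q E o l l +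
          ∑ k ∈ K.erase l, F k s * lumpedMatrix Q E o k l)
        = Real.exp (q * s) * ∑ k ∈ K.erase l, F k s * lumpedMatrix Q E o k l := by
          rw [hq]; ring
      _ ≤ Real.exp (q * s) * c := mul_le_mul_of_nonneg_left h1 (Real.exp_nonneg _)
      _ ≤ Real.exp (q * T) * c := mul_le_mul_of_nonneg_right h2 hc0

/-- If, under `P_μ`, the killed lumped law has the form `e^{-αt} μ̄`, then the lumped equation
holds. -/
lemma lumpedEquation_of_taboo_eq (hX : IsMarkovChain X P Q) (hcons : IsConservative Q)
    (hne : IsNonexplosive X P) (hlump : IsLumpable Q E o) (hμ : μ.support ⊆ (E.block o)ᶜ) {α : ℝ}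
    (hα : 0 ≤ α)
    (ha : ∀ t : ℝ≥0, taboo X (startFrom P μ) (E.block o)ᶜ t Set.univ = Real.exp (-α * t))
    (hf : ∀ (t : ℝ≥0) l, taboo X (startFrom P μ) (E.block o)ᶜ t (E.block l) =
      Real.exp (-α * t) * lumpedLaw μ E l) :
    LumpedEquation Q μ E o α := by
  classical
  have hle : ∀ s k, taboo X (startFrom P μ) (E.block o)ᶜ s (E.block k) ≤ lumpedLaw μ E k := by
    intro s k
    rw [hf]
    refine mul_le_of_le_one_left (lumpedLaw_nonneg _ _ _) (Real.exp_le_one_iff.2 ?_)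
    exact mul_nonpos_of_nonpos_of_nonneg (by linarith) s.coe_nonneg
  intro l
  by_cases hlo : l = o
  · subst hlo
    simpa [lumpedLaw_self hμ] using
      hasSum_absorption_rate_of_constant hX hcons hne hlump hμ ha hle
  rw [Set.indicator_of_notMem (by simpa using hlo), mul_zero, add_zero]
  set m := lumpedLaw μ E
  set q := lumpedMatrix Q E o
  -- the flow into the block `l` from the other blocks
  set w : ι → ℝ := fun k => if k = l then 0 else m k * q k l with hw
  have hw0 : ∀ k, 0 ≤ w k := fun k => by
    simp only [hw]
    split_ifs with hkl
    · exact le_rfl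
    · exact mul_nonneg (lumpedLaw_nonneg _ _ _) (lumpedMatrix_nonneg hX (Ne.symm hkl))
  have hwK : ∀ K : Finset ι, l ∉ K → ∑ k ∈ K, w k = ∑ k ∈ K, m k * q k l := fun K hK =>
    Finset.sum_congr rfl fun k hk => if_neg (by rintro rfl; exact hK hk)
  have hwle : ∀ K : Finset ι, ∑ k ∈ K, w k ≤ -α * m l - m l * q l l := by
    intro K
    have h1 := sum_lumpedMatrix_le hX hcons hne hlump hμ hlo (fun t => hf t l)
      (Finset.mem_insert_self l (K.erase l))
    rw [Finset.sum_insert (Finset.notMem_erase l K),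
      ← hwK _ (Finset.notMem_erase l K), Finset.sum_erase K (by simp [hw])] at h1
    linarith
  have hs : Summable w := summable_of_sum_le hw0 hwle
  have hge : -α * m l - m l * q l l ≤ ∑' k, w k := by
    set c := ∑' k, w k
    have hbound := exp_mul_le_of_flow_le hX hcons hne hlump hlo hle (c := c) fun K hK => by
      rw [← hwK K hK]
      exact hs.sum_le_tsum K fun k _ => hw0 k
    have hf' := hasDerivWithinAt_exp_mul (-q l l - α) (m l)
    have hg : HasDerivWithinAt (fun T : ℝ => m l + T * (Real.exp (-q l l * T) * c)) c
        (Set.Ici 0) 0 := by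
      have h1 := (((hasDerivAt_id (0 : ℝ)).const_mul (-q l l)).exp.mul_const c)
      have h2 := ((hasDerivAt_id (0 : ℝ)).mul h1).const_add (m l)
      simpa using! h2.hasDerivWithinAt (s := Set.Ici 0)
    have h := le_of_hasDerivWithinAt_of_le hf' hg (by simp) fun T hT => ?_
    · linarith
    · have h1 := hbound T.toNNReal
      rw [hf, Real.coe_toNNReal _ hT, ← mul_assoc, ← Real.exp_add] at h1
      have h2 : -q l l * T + -α * T = (-q l l - α) * T := by ring
      rwa [h2] at h1
  have hwsum : HasSum w (-α * m l - m l * q l l) :=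
    (le_antisymm (hs.tsum_le_of_sum_le hwle) hge) ▸ hs.hasSum
  have hfin := hwsum.add (hasSum_ite_eq l (m l * q l l))
  convert! hfin using 1
  · ext k
    simp only [hw]
    split_ifs with hkl
    · rw [hkl, zero_add]
    · rw [add_zero]
  · ring

lemma occupation_eq_div (hX : IsMarkovChain X P Q) (μ : PMF S) (E : BlockPartition S ι) (o : ι)
    (t : ℝ≥0) (k : ι) :
    occupation X P μ E o t k = taboo X (startFrom P μ) (E.block o)ᶜ t (E.block k) /
      taboo X (startFrom P μ) (E.block o)ᶜ t Set.univ := by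
  have hmeas := hX.measurableSet_stay (E.block o)ᶜ t
  rw [occupation, survival_eq_stay hX.rightContinuous, measureReal_def, cond_apply hmeas,
    ENNReal.toReal_mul, ENNReal.toReal_inv, div_eq_inv_mul]
  simp [taboo, measureReal_def]

/-- By irreducibility, absorption has positive probability. -/
lemma exists_survival_lt_one (hX : IsMarkovChain X P Q) (hirr : IsIrreducible X P) (μ : PMF S)
    (E : BlockPartition S ι) (o : ι) :
    ∃ t, taboo X (startFrom P μ) (E.block o)ᶜ t Set.univ < 1 := by
  have := (hX.isMarkovLaw_startFrom μ).isProbabilityMeasure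
  obtain ⟨i, hi⟩ := μ.support_nonempty
  obtain ⟨t, ht⟩ := hirr i (E.rep o)
  refine ⟨t, ?_⟩
  have hmeas := hX.measurableSet_preimage t (E.block o)
  have hpos : 0 < (startFrom P μ).real {ω | X t ω ∈ E.block o} := by
    rw [measureReal_def, ENNReal.toReal_pos_iff]
    refine ⟨?_, measure_lt_top _ _⟩
    rw [startFrom_apply μ hmeas]
    refine lt_of_lt_of_le ?_ (ENNReal.le_tsum i)
    have h1 : 0 < P i {ω | X t ω = E.rep o} := (ENNReal.toReal_pos_iff.1 ht).1
    have h2 : P i {ω | X t ω = E.rep o} ≤ P i {ω | X t ω ∈ E.block o} := by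
      refine measure_mono fun ω hω => ?_
      have : X t ω = E.rep o := hω
      change X t ω ∈ E.block o
      rw [this, E.mem_block_iff, E.index_rep]
    exact ENNReal.mul_pos ((PMF.mem_support_iff _ _).1 hi) (h1.trans_le h2).ne'
  have hle : taboo X (startFrom P μ) (E.block o)ᶜ t Set.univ ≤
      (startFrom P μ).real {ω | X t ω ∈ E.block o}ᶜ :=
    measureReal_mono fun ω hω => hω.1 t le_rfl
  rw [probReal_compl_eq_one_sub hmeas] at hle
  linarith

/-- If the conditional law of the block is constant, then it equals `μ̄`; hence the survival
probability is multiplicative, and the killed lumped law is `e^{-αt} μ̄`. -/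
lemma exists_taboo_eq_exp_of_occupation (hX : IsMarkovChain X P Q) (hirr : IsIrreducible X P)
    (hcons : IsConservative Q) (hne : IsNonexplosive X P) (hlump : IsLumpable Q E o)
    (hμ : μ.support ⊆ (E.block o)ᶜ)
    (hocc : ∀ k s t, occupation X P μ E o s k = occupation X P μ E o t k) :
    ∃ α : ℝ, 0 < α ∧
      (∀ t : ℝ≥0, taboo X (startFrom P μ) (E.block o)ᶜ t Set.univ = Real.exp (-α * t)) ∧
      ∀ (t : ℝ≥0) l, taboo X (startFrom P μ) (E.block o)ᶜ t (E.block l) =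
        Real.exp (-α * t) * lumpedLaw μ E l := by
  have hν := hX.isMarkovLaw_startFrom μ
  have := hν.isProbabilityMeasure
  set a : ℝ≥0 → ℝ := fun t => taboo X (startFrom P μ) (E.block o)ᶜ t Set.univ with ha
  have hsum := hasSum_lumpedLaw hX μ E
  have ha0 : a 0 = 1 := taboo_startFrom_zero_univ hX hμ
  have hocc' : ∀ t l, taboo X (startFrom P μ) (E.block o)ᶜ t (E.block l) / a t =
      lumpedLaw μ E l := by
    intro t l
    have h := hocc l t 0
    rw [occupation_eq_div hX, occupation_eq_div hX, taboo_startFrom_zero_univ hX hμ, div_one,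
      taboo_startFrom_zero_block hX hμ] at h
    exact h
  -- a vanishing survival probability would make the conditional law zero, instead of `μ̄`
  have hapos : ∀ t, 0 < a t := by
    intro t
    refine lt_of_le_of_ne (taboo_nonneg _ _ _ _) fun h0 => ?_
    have h1 : lumpedLaw μ E = fun _ => 0 := by
      ext l
      rw [← hocc' t l, ← h0, div_zero]
    rw [h1] at hsum
    exact zero_ne_one (hasSum_zero.unique hsum)
  have hf : ∀ t l, taboo X (startFrom P μ) (E.block o)ᶜ t (E.block l) = a t * lumpedLaw μ E l := by
    intro t l
    rw [← hocc' t l, mul_div_cancel₀ _ (hapos t).ne']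
  have hmul : ∀ s t, a (s + t) = a s * a t := by
    intro s t
    have h1 := hasSum_taboo_mul_exit hX hcons hne hlump hν (E := E) (o := o) s t
    have h2 := (hasSum_lumpedLaw_mul_exit hX hcons hne hlump hμ t).mul_left (a s)
    simp only [hf, mul_assoc] at h1
    have h3 := h1.unique h2
    simp only [ha] at h3 ⊢
    linarith
  have hanti : Antitone a := fun s t hst =>
    measureReal_mono (Set.inter_subset_inter (stay_anti _ hst) fun _ _ => trivial)
  obtain ⟨α, hα⟩ := exists_eq_exp_of_antitone hapos hanti hmul
  refine ⟨α, ?_, hα, fun t l => by rw [hf, hα]⟩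
  obtain ⟨t, ht⟩ := exists_survival_lt_one hX hirr μ E o
  have h1 : a t < 1 := ht
  rw [hα, Real.exp_lt_one_iff] at h1
  by_contra hcon
  exact absurd h1 (not_lt.2 (mul_nonneg (by linarith) t.coe_nonneg))

lemma occupation_eq_of_taboo_eq (hX : IsMarkovChain X P Q) {α : ℝ}
    (ha : ∀ t : ℝ≥0, taboo X (startFrom P μ) (E.block o)ᶜ t Set.univ = Real.exp (-α * t))
    (hf : ∀ (t : ℝ≥0) l, taboo X (startFrom P μ) (E.block o)ᶜ t (E.block l) =
      Real.exp (-α * t) * lumpedLaw μ E l) (k : ι) (t : ℝ≥0) :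
    occupation X P μ E o t k = lumpedLaw μ E k := by
  rw [occupation_eq_div hX, ha, hf, mul_div_cancel_left₀ _ (Real.exp_ne_zero _)]

end

end LumpedChain

open LumpedChain in
theorem theorem3 {S Ω ι : Type*} [Countable S] [MeasurableSpace Ω]
    (X : ℝ≥0 → Ω → S) (P : S → Measure Ω) (Q : S → S → ℝ)
    (hX : IsMarkovChain X P Q) (hirr : IsIrreducible X P)
    (hcons : IsConservative Q) (hne : IsNonexplosive X P)
    (D : Set S) (E : BlockPartition S ι) (o : ι) (hD : E.block o = D)
    (μ : PMF S) (hμ : μ.support ⊆ Dᶜ) (hlump : IsLumpable Q E o) :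
    ((∀ k s t, occupation X P μ E o s k = occupation X P μ E o t k) ↔
      ∃ α : ℝ, 0 < α ∧ LumpedEquation Q μ E o α) ∧
    ((∀ k s t, occupation X P μ E o s k = occupation X P μ E o t k) →
      (∀ k t, occupation X P μ E o t k = lumpedLaw μ E k) ∧
      ∃ α : ℝ, 0 < α ∧ LumpedEquation Q μ E o α ∧
        HasSum (fun k => lumpedMatrix Q E o k o * lumpedLaw μ E k) α ∧
        ∀ t : ℝ≥0, (startFrom P μ).real (survival X D t) = Real.exp (-α * t)) := by
  subst hD
  have hforward : (∀ k s t, occupation X P μ E o s k = occupation X P μ E o t k) →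
      (∀ k t, occupation X P μ E o t k = lumpedLaw μ E k) ∧
      ∃ α : ℝ, 0 < α ∧ LumpedEquation Q μ E o α ∧
        HasSum (fun k => lumpedMatrix Q E o k o * lumpedLaw μ E k) α ∧
        ∀ t : ℝ≥0, (startFrom P μ).real (survival X (E.block o) t) = Real.exp (-α * t) := by
    intro hocc
    obtain ⟨α, hα, ha, hf⟩ := exists_taboo_eq_exp_of_occupation hX hirr hcons hne hlump hμ hocc
    have heq := lumpedEquation_of_taboo_eq hX hcons hne hlump hμ hα.le ha hf
    refine ⟨occupation_eq_of_taboo_eq hX ha hf, α, hα, heq, ?_, fun t => ?_⟩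
    · simpa only [mul_comm] using hasSum_absorption_rate hμ heq
    · rw [survival_real_eq hX, ha]
  refine ⟨⟨fun hocc => ?_, ?_⟩, hforward⟩
  · obtain ⟨-, α, hα, heq, -⟩ := hforward hocc
    exact ⟨α, hα, heq⟩
  · rintro ⟨α, hα, heq⟩ k s t
    have h := occupation_eq_of_taboo_eq hX (survival_eq_exp hX hcons hne hlump hμ hα heq)
      (taboo_eq_exp_mul hX hcons hne hlump hμ hα heq) k
    rw [h, h]
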